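/- Let $n=n_x+n_y$, $B\in\mathbb{R}^{n\times n}$, $A\in\mathbb{R}^{n\times m}$, and consider the linear SDE $$dZ_t = BZ_t\,dt + A\,dW_t,\qquad Z_t=(X_t,Y_t)\in\mathbb{R}^{n_x}\times\mathbb{R}^{n_y},$$ where $W$ is a standard $m$-dimensional Brownian motion. Assume that $B$ is Hurwitz (its spectrum lies in the open left half-plane) and that $(B,A)$ is controllable, i.e. $\mathrm{rank}(A,BA,\dots,B^{n-1}A)=n$. Let $\mu$ be the invariant measure of the SDE (the law at every time of a stationary solution whose initial value is independent of $W$), let $K$ be the covariance matrix of $\mu$, and assume that $K$ has an eigenvector $v$ for its largest eigenvalue $\lambda_{\max}(K)$ with $v\notin\ker(AA^T)$. Then $\mu$ has a continuous, strictly positive Lebesgue density, again denoted $\mu(x,y)$, and for every $x\in\mathbb{R}^{n_x}$ the conditional invariant measure $\bar\mu_x$ on $\mathbb{R}^{n_y}$, with density $\bar\mu_x(y)=\mu(x,y)/\int_{\mathbb{R}^{n_y}}\mu(x,y')\,dy'$, is a probability measure that satisfies a logarithmic Sobolev inequality with a positive constant. Its logarithmic Sobolev constant $\alpha_{\mathrm{LSI}}(\bar\mu_x)$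 satisfies $$\alpha_{\mathrm{LSI}}(\bar\mu_x)\;\ge\;\frac{\lambda_{\min}\bigl(-(B+B^T)\bigr)}{\lambda_{\max}(AA^T)} \qquad\text{and also}\qquad \alpha_{\mathrm{LSI}}(\bar\mu_x)\;\ge\;\frac{\lambda_{\min}(B+B^T)}{\lambda_{\max}(AA^T)}.$$ Here $\lambda_{\min},\lambda_{\max}$ are the smallest and largest eigenvalues of a symmetric matrix, and $\alpha_{\mathrm{LSI}}(\nu)\in[0,\infty]$ is the supremum of all $\alpha>0$ such that $\mathcal H(\zeta|\nu)\le\frac1{2\alpha}\mathcal R(\zeta|\nu)$ for every probability measure $\zeta\ll\nu$ (and $0$ if there is no such $\alpha$), where $\mathcal H(\zeta|\nu)=\int\log\frac{d\zeta}{d\nu}\,d\zeta$ is the relative entropy and $\mathcal R(\zeta|\nu)=\int\bigl|\nabla\log\frac{d\zeta}{d\nu}\bigr|^2d\zeta$ is the relative Fisher information, with a weak gradient, and equal to $+\infty$ if $\nabla\log\frac{d\zeta}{d\nu}$ does not exist in $L^2(\zeta)$. -/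

import Mathlib

open MeasureTheory ProbabilityTheory Matrix
open scoped NNReal ENNReal

noncomputable section

/-- Smallest eigenvalue of a real symmetric matrix. -/
def lambdaMin {ι : Type*} [Fintype ι] [DecidableEq ι] (M : Matrix ι ι ℝ) : ℝ :=
  sInf (spectrum ℝ M)

/-- Largest eigenvalue of a real symmetric matrix. -/
def lambdaMax {ι : Type*} [Fintype ι] [DecidableEq ι] (M : Matrix ι ι ℝ) : ℝ :=
  sSup (spectrum ℝ M)

/-- A real square matrix is Hurwitz if its complex spectrum lies in the open left half-plane. -/
def IsHurwitz {ι : Type*} [Fintype ι] [DecidableEq ι] (B : Matrix ι ι ℝ) : Prop :=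
  ∀ z ∈ spectrum ℂ (B.map (fun r : ℝ => (r : ℂ))), z.re < 0

/-- The block matrix `(A, B A, B² A, …, B^(n-1) A)`, where `n` is the size of `B`. -/
def controllabilityMatrix {ι κ : Type*} [Fintype ι] [DecidableEq ι]
    (B : Matrix ι ι ℝ) (A : Matrix ι κ ℝ) : Matrix ι (Fin (Fintype.card ι) × κ) ℝ :=
  Matrix.of fun i p => (B ^ (p.1 : ℕ) * A) i p.2

/-- The pair `(B, A)` is controllable: `rank (A, B A, …, B^(n-1) A) = n`. -/
def IsControllable {ι κ : Type*} [Fintype ι] [DecidableEq ι] [Fintype κ]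
    (B : Matrix ι ι ℝ) (A : Matrix ι κ ℝ) : Prop :=
  (controllabilityMatrix B A).rank = Fintype.card ι

/-- Standard Brownian motion in `ℝ^κ`: the coordinates are independent standard real Brownian
motions. -/
structure IsBrownianMotion {Ω κ : Type*} [MeasurableSpace Ω] [Fintype κ]
    (W : ℝ≥0 → Ω → EuclideanSpace ℝ κ) (P : Measure Ω) : Prop where
  measurable : ∀ t, Measurable (W t)
  isBrownian : ∀ i, IsBrownianReal (fun t ω => W t ω i) P
  indep : iIndepFun (fun (i : κ) (ω : Ω) (t : ℝ≥0) => W t ω i) P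

/-- `Z` solves `dZ = B Z dt + A dW` with initial value `Z 0` independent of `W`. Since `A` is
constant, the Itô integral `∫₀ᵗ A dW` is `A W_t`, and the equation is an identity between
continuous paths. -/
structure IsLinearSDESolution {Ω ι κ : Type*} [MeasurableSpace Ω] [Fintype ι] [DecidableEq ι]
    [Fintype κ] [DecidableEq κ] (B : Matrix ι ι ℝ) (A : Matrix ι κ ℝ)
    (W : ℝ≥0 → Ω → EuclideanSpace ℝ κ) (Z : ℝ≥0 → Ω → EuclideanSpace ℝ ι)
    (P : Measure Ω) : Prop where
  measurable : ∀ t, Measurable (Z t)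
  indep_initial : IndepFun (Z 0) (fun (ω : Ω) (t : ℝ≥0) => W t ω) P
  continuous_paths : ∀ᵐ ω ∂P, Continuous fun t : ℝ≥0 => Z t ω
  equation : ∀ᵐ ω ∂P, ∀ t : ℝ≥0,
    Z t ω = Z 0 ω + (∫ s in (0 : ℝ)..(t : ℝ), Matrix.toEuclideanLin B (Z s.toNNReal ω))
      + Matrix.toEuclideanLin A (W t ω)

/-- Covariance matrix of a measure on `ℝ^ι`. -/
def covarianceMatrix {ι : Type*} (μ : Measure (EuclideanSpace ℝ ι)) : Matrix ι ι ℝ :=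
  Matrix.of fun i j => covariance (fun z : EuclideanSpace ℝ ι => z i) (fun z => z j) μ

/-- The point `(x, y)` of `ℝ^(n_x + n_y)`. -/
def joinPoint {ι κ : Type*} (x : EuclideanSpace ℝ ι) (y : EuclideanSpace ℝ κ) :
    EuclideanSpace ℝ (ι ⊕ κ) :=
  WithLp.toLp 2 (Sum.elim x.ofLp y.ofLp)

/-- For a probability density `ρ` on `ℝ^(n_x + n_y)`, the conditional measure of `y` given `x`:
it has the Lebesgue density `y ↦ ρ (x, y) / ∫ ρ (x, y') dy'`. -/
def conditionalMeasure {ι κ : Type*} [Fintype κ] (ρ : EuclideanSpace ℝ (ι ⊕ κ) → ℝ)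
    (x : EuclideanSpace ℝ ι) : Measure (EuclideanSpace ℝ κ) :=
  volume.withDensity fun y =>
    ENNReal.ofReal (ρ (joinPoint x y) / ∫ y' : EuclideanSpace ℝ κ, ρ (joinPoint x y'))

/-- `g = ∇ log h` in the weak sense, with `h = dζ/dν` and `∇ log h ∈ L²(ζ)`: the distributional
gradient of `h` on `ℝ^κ` is `h g`. (For `ν` with a continuous positive Lebesgue density, `h` and
`h g` are locally Lebesgue integrable.) -/
def IsWeakLogGradient {κ : Type*} [Fintype κ] (ζ ν : Measure (EuclideanSpace ℝ κ))
    (g : EuclideanSpace ℝ κ → EuclideanSpace ℝ κ) : Prop :=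
  MemLp g 2 ζ ∧
  ∀ φ : EuclideanSpace ℝ κ → ℝ, ContDiff ℝ ((⊤ : ℕ∞) : WithTop ℕ∞) φ → HasCompactSupport φ →
    ∀ w : EuclideanSpace ℝ κ,
      ∫ y, (ζ.rnDeriv ν y).toReal * fderiv ℝ φ y w
        = - ∫ y, (ζ.rnDeriv ν y).toReal * inner ℝ (g y) w * φ y

open scoped Classical in
/-- Relative Fisher information `R(ζ|ν) = ∫ |∇ log (dζ/dν)|² dζ` if `ζ ≪ ν` and
`∇ log (dζ/dν) ∈ L²(ζ)`, and `∞` otherwise. The weak logarithmic gradient is `ζ`-a.e. unique, so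
the infimum is over a single value, or over the empty set (giving `∞`). -/
def fisherInformation {κ : Type*} [Fintype κ] (ζ ν : Measure (EuclideanSpace ℝ κ)) : ℝ≥0∞ :=
  if ζ ≪ ν then
    ⨅ (g : EuclideanSpace ℝ κ → EuclideanSpace ℝ κ) (_ : IsWeakLogGradient ζ ν g),
      ∫⁻ y, ‖g y‖ₑ ^ 2 ∂ζ
  else ∞

/-- `ν` satisfies the logarithmic Sobolev inequality with constant `α > 0`:
`H(ζ|ν) ≤ R(ζ|ν) / (2 α)` for all probability measures `ζ ≪ ν`, with `H` the relative entropy. -/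
def SatisfiesLSI {κ : Type*} [Fintype κ] (ν : Measure (EuclideanSpace ℝ κ)) (α : ℝ) : Prop :=
  0 < α ∧ ∀ ζ : Measure (EuclideanSpace ℝ κ), IsProbabilityMeasure ζ → ζ ≪ ν →
    InformationTheory.klDiv ζ ν ≤ ENNReal.ofReal (1 / (2 * α)) * fisherInformation ζ ν

/-- The logarithmic Sobolev constant of `ν`: the best constant, i.e. the supremum of all `α > 0`
with which `ν` satisfies the inequality (`0` if there is none). -/
def logSobolevConstant {κ : Type*} [Fintype κ] (ν : Measure (EuclideanSpace ℝ κ)) : ℝ≥0∞ :=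
  ⨆ (α : ℝ) (_ : SatisfiesLSI ν α), ENNReal.ofReal α

end

/-! The invariant measure is the centered Gaussian whose covariance `K` solves the Lyapunov equation
`B K + K Bᵀ = -A Aᵀ`. Conditioning a Gaussian on `x` gives a Gaussian in `y` whose precision matrix
is the lower diagonal block of `K⁻¹`, whatever `x` is. Since `K⁻¹ ≥ 1/λ_max(K)`, this block is at
least `1/λ_max(K)`, and a Gaussian with precision at least `α` satisfies the logarithmic Sobolev
inequality with constant `α`. Thus `α_LSI ≥ 1/λ_max(K)`.

Testing the Lyapunov equation against the top eigenvector `v` gives `λ_max(K) ⟨v, -(B + Bᵀ) v⟩ = ⟨v,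
A Aᵀ v⟩`. The right side is at most `λ_max(A Aᵀ) |v|²`, which bounds `1/λ_max(K)` from below by the
first quotient. It is also positive because `A Aᵀ v ≠ 0`, so `⟨v, (B + Bᵀ) v⟩ < 0`; the second
quotient is therefore nonpositive and that bound is trivial (`lambdaMin_div_lambdaMax_le`).

The Gaussian inequality is proved by interpolating between `f` and its mean through `E f(cos θ x +
sin θ Y)`, the Ornstein-Uhlenbeck semigroup with `cos θ` in place of `e^{-t}`: the entropy
production is a Fisher information, which decreases along the interpolation
(`integral_klFun_stdGaussian_le`). Cutoff, mollification and Fatou's lemma extend the inequality to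
weakly differentiable densities (`SmoothLSI.satisfiesLSI`).

Gaussianity needs no stochastic calculus. Over a short time `δ` the solution is `e^{δB} Z₀ + A W_δ`
up to an error of order `δ^{3/2}` in mean. Stationarity turns this into a differential equation for
the characteristic function along the orbits of `e^{sBᵀ}`, which tend to `0` because `B` is Hurwitz
(`charFun_eq_exp_of_norm_charFun_sub_le`). Controllability makes `K` positive definite
(`IsControllable.posDef`). -/

set_option linter.unusedSectionVars false

/-! ### Density, integration by parts and rotation invariance of the standard Gaussian -/

section StdGaussian

variable {E : Type*} [NormedAddCommGroup E] [InnerProductSpace ℝ E] [FiniteDimensional ℝ E]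
  [MeasurableSpace E] [BorelSpace E]

/-- The Lebesgue density of the standard Gaussian measure. -/
noncomputable def stdGaussianDensity (E : Type*) [NormedAddCommGroup E] [InnerProductSpace ℝ E]
    (x : E) : ℝ :=
  ((Real.pi / (1 / 2)) ^ (Module.finrank ℝ E / 2 : ℝ))⁻¹ * Real.exp (-(1 / 2) * ‖x‖ ^ 2)

omit [FiniteDimensional ℝ E] [MeasurableSpace E] [BorelSpace E] in
theorem stdGaussianDensity_pos (x : E) : 0 < stdGaussianDensity E x := by
  unfold stdGaussianDensity; positivity

omit [FiniteDimensional ℝ E] [MeasurableSpace E] [BorelSpace E] in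
@[fun_prop]
theorem continuous_stdGaussianDensity : Continuous (stdGaussianDensity E) := by
  unfold stdGaussianDensity; fun_prop

theorem integrable_stdGaussianDensity : Integrable (stdGaussianDensity E) := by
  refine Integrable.const_mul ?_ _
  have h := GaussianFourier.integral_rexp_neg_mul_sq_norm (V := E) (b := 1 / 2) (by norm_num)
  by_contra hc
  rw [integral_undef hc] at h
  have : 0 < (Real.pi / (1 / 2)) ^ (Module.finrank ℝ E / 2 : ℝ) := by positivity
  exact this.ne h

/-- Both measures are finite and have the same characteristic function, by the Gaussian Fourier
integral. -/
theorem stdGaussian_eq_withDensity :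
    stdGaussian E = volume.withDensity fun x => ENNReal.ofReal (stdGaussianDensity E x) := by
  have : IsFiniteMeasure
      ((volume : Measure E).withDensity fun x => ENNReal.ofReal (stdGaussianDensity E x)) :=
    isFiniteMeasure_withDensity_ofReal integrable_stdGaussianDensity.2
  apply Measure.ext_of_charFun
  ext t
  rw [charFun_stdGaussian, charFun_apply,
    integral_withDensity_eq_integral_toReal_smul (by fun_prop) (by simp)]
  have h := GaussianFourier.integral_cexp_neg_mul_sq_norm_add (V := E) (b := 1 / 2)
    (by norm_num) Complex.I t
  have hc : (((Real.pi / (1 / 2)) ^ (Module.finrank ℝ E / 2 : ℝ) : ℝ) : ℂ)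
      = (Real.pi / (1 / 2) : ℂ) ^ (Module.finrank ℝ E / 2 : ℂ) := by
    rw [Complex.ofReal_cpow (by positivity)]; push_cast; rfl
  have hc0 : (((Real.pi / (1 / 2)) ^ (Module.finrank ℝ E / 2 : ℝ) : ℝ) : ℂ) ≠ 0 := by
    have : 0 < (Real.pi / (1 / 2)) ^ (Module.finrank ℝ E / 2 : ℝ) := by positivity
    exact_mod_cast this.ne'
  have h2 : ∀ x : E, (ENNReal.ofReal (stdGaussianDensity E x)).toReal •
      Complex.exp (inner ℝ x t * Complex.I)
      = (((Real.pi / (1 / 2)) ^ (Module.finrank ℝ E / 2 : ℝ) : ℝ) : ℂ)⁻¹ *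
        Complex.exp (-(1 / 2) * ‖x‖ ^ 2 + Complex.I * inner ℝ t x) := by
    intro x
    rw [ENNReal.toReal_ofReal (stdGaussianDensity_pos x).le, Complex.real_smul,
      Complex.exp_add, stdGaussianDensity, real_inner_comm]
    push_cast
    rw [mul_assoc, mul_comm Complex.I]
  simp_rw [h2]
  rw [integral_const_mul, h, ← hc, inv_mul_cancel_left₀ hc0]
  congr 1
  rw [Complex.I_sq]; ring

omit [MeasurableSpace E] [BorelSpace E] [FiniteDimensional ℝ E] in
theorem hasFDerivAt_stdGaussianDensity (x : E) :
    HasFDerivAt (stdGaussianDensity E) (-(stdGaussianDensity E x) • innerSL ℝ x) x := by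
  have h := (((hasStrictFDerivAt_norm_sq x).hasFDerivAt.const_mul (-(1 / 2))).exp).const_mul
    ((Real.pi / (1 / 2)) ^ (Module.finrank ℝ E / 2 : ℝ))⁻¹
  refine h.congr_fderiv ?_
  ext y
  simp [stdGaussianDensity]
  ring

theorem integrable_stdGaussian_iff {f : E → ℝ} :
    Integrable f (stdGaussian E) ↔ Integrable fun x => stdGaussianDensity E x * f x := by
  rw [stdGaussian_eq_withDensity, integrable_withDensity_iff_integrable_smul' (by fun_prop)
    (by simp)]
  simp [ENNReal.toReal_ofReal (stdGaussianDensity_pos _).le]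

theorem integral_stdGaussian (f : E → ℝ) :
    ∫ x, f x ∂(stdGaussian E) = ∫ x, stdGaussianDensity E x * f x := by
  rw [stdGaussian_eq_withDensity,
    integral_withDensity_eq_integral_toReal_smul (by fun_prop) (by simp)]
  simp [ENNReal.toReal_ofReal (stdGaussianDensity_pos _).le]

theorem integrable_norm_stdGaussian : Integrable (fun x : E => ‖x‖) (stdGaussian E) :=
  (IsGaussian.integrable_id (μ := stdGaussian E)).norm

/-- Gaussian integration by parts. -/
theorem integral_mul_inner_stdGaussian {k : E → ℝ} {k' : E → E} {C : ℝ}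
    (hk : ∀ x, HasGradientAt k (k' x) x) (hkC : ∀ x, |k x| ≤ C) (hk'C : ∀ x, ‖k' x‖ ≤ C)
    (a : E) :
    ∫ x, k x * inner ℝ a x ∂(stdGaussian E) = ∫ x, inner ℝ (k' x) a ∂(stdGaussian E) := by
  have hfd : ∀ x, HasFDerivAt k (innerSL ℝ (k' x)) x := fun x => hk x
  have hkcont : Continuous k := continuous_iff_continuousAt.2 fun x => (hfd x).continuousAt
  have hmeas : Measurable fun x => inner ℝ (k' x) a := by
    have : (fun x => inner ℝ (k' x) a) = fun x => fderiv ℝ k x a := by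
      ext x; rw [(hfd x).fderiv]; rfl
    rw [this]; exact measurable_fderiv_apply_const ℝ k a
  rw [integral_stdGaussian, integral_stdGaussian]
  have h1 : Integrable fun x => stdGaussianDensity E x * inner ℝ (k' x) a := by
    rw [← integrable_stdGaussian_iff]
    refine Integrable.mono' (integrable_const (C * ‖a‖)) hmeas.aestronglyMeasurable
      (.of_forall fun x => (norm_inner_le_norm _ _).trans ?_)
    gcongr; exact hk'C x
  have h2 : Integrable fun x => stdGaussianDensity E x * (k x * inner ℝ a x) := by
    rw [← integrable_stdGaussian_iff]
    refine Integrable.mono' (integrable_norm_stdGaussian.const_mul (C * ‖a‖))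
      (by fun_prop) (.of_forall fun x => ?_)
    rw [norm_mul, mul_assoc]
    gcongr
    · exact (norm_nonneg _).trans (hk'C x)
    · exact hkC x
    · exact norm_inner_le_norm _ _
  have h3 : Integrable fun x => stdGaussianDensity E x * k x := by
    rw [← integrable_stdGaussian_iff]
    exact Integrable.mono' (integrable_const C) (by fun_prop) (.of_forall hkC)
  -- Integration by parts for Lebesgue measure; the gradient of the Gaussian density is `-x` times
  -- the density, which produces the factor `⟨a, x⟩`.
  have key := integral_bilinear_hasFDerivAt_right_eq_neg_left_of_integrable
    (μ := (volume : Measure E)) (B := ContinuousLinearMap.mul ℝ ℝ)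
    (f := k) (f' := fun x => innerSL ℝ (k' x)) (g := stdGaussianDensity E)
    (g' := fun x => -(stdGaussianDensity E x) • innerSL ℝ x) (v := a)
    (by simpa [mul_comm] using h1) 
    (by convert h2.neg using 2 with x; simp [real_inner_comm x a]; ring)
    (by simpa [mul_comm] using h3) (fun x _ => hfd x)
    (fun x _ => hasFDerivAt_stdGaussianDensity x)
  simp only [ContinuousLinearMap.mul_apply', _root_.smul_apply, innerSL_apply_apply,
    smul_eq_mul] at key
  have e1 : ∀ x, stdGaussianDensity E x * (k x * inner ℝ a x)
      = -(k x * (-stdGaussianDensity E x * inner ℝ x a)) := by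
    intro x; rw [real_inner_comm x a]; ring
  simp_rw [e1]
  rw [integral_neg, key, neg_neg]
  simp_rw [mul_comm]

/-- Two independent standard Gaussian vectors stay so after a rotation of the pair. This replaces
the semigroup property in the interpolation argument. -/
theorem measurePreserving_rotation_stdGaussian (θ : ℝ) :
    MeasurePreserving (fun p : E × E => (Real.cos θ • p.1 + Real.sin θ • p.2,
        -Real.sin θ • p.1 + Real.cos θ • p.2))
      ((stdGaussian E).prod (stdGaussian E)) ((stdGaussian E).prod (stdGaussian E)) := by
  refine ⟨by fun_prop, ?_⟩
  exact IsGaussian.map_rotation_eq_self_of_forall_strongDual_eq_zero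
    integral_strongDual_stdGaussian θ

end StdGaussian

/-! ### The logarithmic Sobolev inequality of the standard Gaussian, by rotation interpolation -/

section GaussianLSI

variable {E : Type*} [NormedAddCommGroup E] [InnerProductSpace ℝ E] [FiniteDimensional ℝ E]
  [MeasurableSpace E] [BorelSpace E]

/-- The average of `f` over the rotated Gaussian variable `cos θ x + sin θ Y`. -/
noncomputable def rotationAverage {F : Type*} [NormedAddCommGroup F] [NormedSpace ℝ F]
    (f : E → F) (θ : ℝ) (x : E) : F :=
  ∫ y, f (Real.cos θ • x + Real.sin θ • y) ∂(stdGaussian E)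

/-- The derivative in `θ` of `rotationAverage f θ x`, for `f` with gradient `D`. -/
noncomputable def rotationAverageDeriv (D : E → E) (θ : ℝ) (x : E) : ℝ :=
  ∫ y, inner ℝ (D (Real.cos θ • x + Real.sin θ • y)) (-Real.sin θ • x + Real.cos θ • y)
    ∂(stdGaussian E)

theorem integrable_of_continuous_bounded {F : Type*} [NormedAddCommGroup F]
    [SecondCountableTopology F] {μ : Measure E} [IsFiniteMeasure μ]
    {f : E → F} (hf : Continuous f) {K : ℝ} (hK : ∀ x, ‖f x‖ ≤ K) : Integrable f μ :=
  Integrable.mono' (integrable_const K) hf.aestronglyMeasurable (.of_forall hK)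

variable {f : E → ℝ} {D : E → E} {ε K : ℝ}

theorem norm_inner_rotation_le (hDK : ∀ x, ‖D x‖ ≤ K) (θ : ℝ) (x y : E) :
    ‖inner ℝ (D (Real.cos θ • x + Real.sin θ • y)) (-Real.sin θ • x + Real.cos θ • y)‖
      ≤ K * (‖x‖ + ‖y‖) := by
  refine (norm_inner_le_norm _ _).trans ?_
  have hK : 0 ≤ K := (norm_nonneg _).trans (hDK 0)
  gcongr
  · exact hDK _
  · refine (norm_add_le _ _).trans ?_
    rw [norm_smul, norm_smul, norm_neg]
    gcongr
    · exact mul_le_of_le_one_left (norm_nonneg _) (Real.abs_sin_le_one θ)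
    · exact mul_le_of_le_one_left (norm_nonneg _) (Real.abs_cos_le_one θ)

theorem hasDerivAt_rotationAverage (hf : ∀ x, HasGradientAt f (D x) x) (hD : Continuous D)
    (hfK : ∀ x, |f x| ≤ K) (hDK : ∀ x, ‖D x‖ ≤ K) (θ : ℝ) (x : E) :
    HasDerivAt (fun θ => rotationAverage f θ x) (rotationAverageDeriv D θ x) θ := by
  have hfc : Continuous f := continuous_iff_continuousAt.2 fun x => (hf x).continuousAt
  refine (hasDerivAt_integral_of_dominated_loc_of_deriv_le (s := Set.univ) Filter.univ_mem
    (F := fun θ y => f (Real.cos θ • x + Real.sin θ • y))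
    (F' := fun θ y => inner ℝ (D (Real.cos θ • x + Real.sin θ • y))
      (-Real.sin θ • x + Real.cos θ • y))
    (bound := fun y => K * (‖x‖ + ‖y‖)) (.of_forall fun θ => by fun_prop)
    (integrable_of_continuous_bounded (by fun_prop) fun y => hfK _)
    (by fun_prop) (.of_forall fun y θ _ => norm_inner_rotation_le hDK θ x y)
    (((integrable_const ‖x‖).add integrable_norm_stdGaussian).const_mul K)
    (.of_forall fun y θ _ => ?_)).2
  have h1 : HasDerivAt (fun θ => Real.cos θ • x + Real.sin θ • y)
      (-Real.sin θ • x + Real.cos θ • y) θ :=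
    ((Real.hasDerivAt_cos θ).smul_const x).add ((Real.hasDerivAt_sin θ).smul_const y)
  exact (hf _).hasFDerivAt.comp_hasDerivAt θ h1

/-- The commutation of gradient and semigroup: the factor `cos θ` plays the role of `e^{-t}`, and it
is what makes the final constant dimension-free. -/
theorem hasGradientAt_rotationAverage (hf : ∀ x, HasGradientAt f (D x) x) (hD : Continuous D)
    (hfK : ∀ x, |f x| ≤ K) (hDK : ∀ x, ‖D x‖ ≤ K) (θ : ℝ) (x : E) :
    HasGradientAt (rotationAverage f θ) (Real.cos θ • rotationAverage D θ x) x := by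
  have hfc : Continuous f := continuous_iff_continuousAt.2 fun x => (hf x).continuousAt
  have h := hasFDerivAt_integral_of_dominated_of_fderiv_le (𝕜 := ℝ) (x₀ := x)
    (μ := stdGaussian E) (s := Set.univ) Filter.univ_mem
    (F := fun x y => f (Real.cos θ • x + Real.sin θ • y))
    (F' := fun x y => innerSL ℝ (Real.cos θ • D (Real.cos θ • x + Real.sin θ • y)))
    (bound := fun _ => |Real.cos θ| * K) (.of_forall fun θ => by fun_prop)
    (integrable_of_continuous_bounded (by fun_prop) fun y => hfK _)
    (by fun_prop) (.of_forall fun y x _ => by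
      rw [innerSL_apply_norm, norm_smul, Real.norm_eq_abs]; gcongr; exact hDK _)
    (integrable_const _)
    (.of_forall fun y x _ => ?_)
  · have hi : Integrable (fun y => Real.cos θ • D (Real.cos θ • x + Real.sin θ • y))
        (stdGaussian E) :=
      (integrable_of_continuous_bounded (by fun_prop) fun y => hDK _).smul _
    rw [ContinuousLinearMap.integral_comp_comm _ hi, integral_smul] at h
    exact h
  · have h1 : HasFDerivAt (fun x : E => Real.cos θ • x + Real.sin θ • y)
        (Real.cos θ • ContinuousLinearMap.id ℝ E) x :=
      ((hasFDerivAt_id x).const_smul _).add_const _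
    refine ((hf _).hasFDerivAt.comp x h1).congr_fderiv ?_
    ext z
    simp

theorem norm_rotationAverage_le {F : Type*} [NormedAddCommGroup F] [NormedSpace ℝ F]
    {g : E → F} (hg : ∀ x, ‖g x‖ ≤ K) (θ : ℝ) (x : E) : ‖rotationAverage g θ x‖ ≤ K := by
  refine (norm_integral_le_of_norm_le_const (.of_forall fun y => hg _)).trans ?_
  simp

theorem le_rotationAverage (hfc : Continuous f) (hfK : ∀ x, |f x| ≤ K) (hε : ∀ x, ε ≤ f x)
    (θ : ℝ) (x : E) : ε ≤ rotationAverage f θ x := by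
  have := integral_mono (μ := stdGaussian E) (integrable_const ε)
    (integrable_of_continuous_bounded (f := fun y => f (Real.cos θ • x + Real.sin θ • y))
      (by fun_prop) fun y => hfK _) fun y => hε _
  rw [integral_const] at this
  simpa [rotationAverage] using this

theorem continuous_rotationAverage {F : Type*} [NormedAddCommGroup F] [NormedSpace ℝ F]
    [SecondCountableTopology F]
    {g : E → F} (hgc : Continuous g) (hg : ∀ x, ‖g x‖ ≤ K) (θ : ℝ) :
    Continuous (rotationAverage g θ) :=
  continuous_of_dominated (fun x => by fun_prop) (fun x => .of_forall fun y => hg _)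
    (integrable_const K) (.of_forall fun y => by fun_prop)

theorem abs_log_le_of_mem {ε K u : ℝ} (hε : 0 < ε) (h1 : ε ≤ u) (h2 : u ≤ K) :
    |Real.log u| ≤ |Real.log ε| + |Real.log K| := by
  have hl := Real.log_le_log hε h1
  have hu := Real.log_le_log (hε.trans_le h1) h2
  rw [abs_le]
  constructor
  · linarith [neg_abs_le (Real.log ε), abs_nonneg (Real.log K)]
  · linarith [le_abs_self (Real.log K), abs_nonneg (Real.log ε)]

theorem measurable_rotationAverageDeriv (hD : Continuous D) (θ : ℝ) :
    StronglyMeasurable (rotationAverageDeriv D θ) := by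
  have : Continuous (Function.uncurry fun x y : E =>
      inner ℝ (D (Real.cos θ • x + Real.sin θ • y)) (-Real.sin θ • x + Real.cos θ • y)) := by
    unfold Function.uncurry; fun_prop
  exact this.stronglyMeasurable.integral_prod_right

theorem norm_rotationAverageDeriv_le (hDK : ∀ x, ‖D x‖ ≤ K) (θ : ℝ) (x : E) :
    ‖rotationAverageDeriv D θ x‖ ≤ K * (‖x‖ + ∫ y : E, ‖y‖ ∂(stdGaussian E)) := by
  refine (norm_integral_le_of_norm_le
    (((integrable_const ‖x‖).add integrable_norm_stdGaussian).const_mul K)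
    (.of_forall fun y => norm_inner_rotation_le hDK θ x y)).trans (le_of_eq ?_)
  rw [integral_const_mul]
  congr 1
  exact (integral_add (integrable_const _) integrable_norm_stdGaussian).trans (by simp)

/-- Differentiation under the integral. The logarithm is bounded since the averages stay in `[ε,
K]`, and the derivative of the average grows at most linearly in `‖x‖`, which is Gaussian
integrable. -/
theorem hasDerivAt_entropy_rotationAverage (hf : ∀ x, HasGradientAt f (D x) x)
    (hD : Continuous D) (hε : 0 < ε) (hεf : ∀ x, ε ≤ f x)
    (hfK : ∀ x, |f x| ≤ K) (hDK : ∀ x, ‖D x‖ ≤ K) (θ : ℝ) :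
    HasDerivAt (fun θ => ∫ x, rotationAverage f θ x * Real.log (rotationAverage f θ x)
        ∂(stdGaussian E))
      (∫ x, (Real.log (rotationAverage f θ x) + 1) * rotationAverageDeriv D θ x
        ∂(stdGaussian E)) θ := by
  have hfc : Continuous f := continuous_iff_continuousAt.2 fun x => (hf x).continuousAt
  have hHc : ∀ θ, Continuous (rotationAverage f θ) := continuous_rotationAverage hfc hfK
  have hHε : ∀ θ x, ε ≤ rotationAverage f θ x := le_rotationAverage hfc hfK hεf
  have hHK : ∀ θ x, |rotationAverage f θ x| ≤ K := fun θ x =>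
    norm_rotationAverage_le (g := f) hfK θ x
  have hH0 : ∀ θ x, rotationAverage f θ x ≠ 0 := fun θ x => (hε.trans_le (hHε θ x)).ne'
  have hlogc : ∀ θ, Continuous fun x => Real.log (rotationAverage f θ x) :=
    fun θ => (hHc θ).log (hH0 θ)
  set C := |Real.log ε| + |Real.log K| with hC
  have hlog : ∀ θ x, |Real.log (rotationAverage f θ x)| ≤ C := fun θ x =>
    abs_log_le_of_mem hε (hHε θ x) ((le_abs_self _).trans (hHK θ x))
  have hC0 : 0 ≤ C := by positivity
  have hK0 : 0 ≤ K := (abs_nonneg _).trans (hfK 0)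
  refine (hasDerivAt_integral_of_dominated_loc_of_deriv_le (s := Set.univ) Filter.univ_mem
    (F := fun θ x => rotationAverage f θ x * Real.log (rotationAverage f θ x))
    (F' := fun θ x => (Real.log (rotationAverage f θ x) + 1) * rotationAverageDeriv D θ x)
    (bound := fun x => (C + 1) * (K * (‖x‖ + ∫ y : E, ‖y‖ ∂(stdGaussian E))))
    (.of_forall fun θ => ((hHc θ).mul (hlogc θ)).aestronglyMeasurable)
    (integrable_of_continuous_bounded (K := K * C) ((hHc θ).mul (hlogc θ)) fun x => ?_)
    (((hlogc θ).add continuous_const).aestronglyMeasurable.mul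
      (measurable_rotationAverageDeriv hD θ).aestronglyMeasurable)
    (.of_forall fun x θ _ => ?_)
    (((integrable_norm_stdGaussian.add (integrable_const _)).const_mul K).const_mul _)
    (.of_forall fun x θ _ => ?_)).2
  · rw [norm_mul]; gcongr; exacts [hHK _ _, hlog _ _]
  · rw [norm_mul]
    gcongr
    · refine (norm_add_le _ _).trans ?_
      rw [norm_one]; gcongr; exact hlog _ _
    · exact norm_rotationAverageDeriv_le hDK θ x
  · have h1 := hasDerivAt_rotationAverage hf hD hfK hDK θ x
    have h2 := (Real.hasDerivAt_mul_log (hH0 θ x)).comp θ h1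
    exact h2

/-- The entropy production formula. In the rotated variables `u = cos θ x + sin θ y`, `v = -sin θ x
+ cos θ y` the derivative is linear in `v`, so Gaussian integration by parts in `v` moves it onto
the logarithm. Rotating back leaves a Fisher information. -/
theorem integral_log_mul_rotationAverageDeriv (hf : ∀ x, HasGradientAt f (D x) x)
    (hD : Continuous D) (hε : 0 < ε) (hεf : ∀ x, ε ≤ f x)
    (hfK : ∀ x, |f x| ≤ K) (hDK : ∀ x, ‖D x‖ ≤ K) (θ : ℝ) :
    ∫ x, (Real.log (rotationAverage f θ x) + 1) * rotationAverageDeriv D θ x ∂(stdGaussian E)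
      = -(Real.sin θ * Real.cos θ) *
        ∫ x, ‖rotationAverage D θ x‖ ^ 2 / rotationAverage f θ x ∂(stdGaussian E) := by
  have hfc : Continuous f := continuous_iff_continuousAt.2 fun x => (hf x).continuousAt
  have hHc : Continuous (rotationAverage f θ) := continuous_rotationAverage hfc hfK θ
  have hGc : Continuous (rotationAverage D θ) := continuous_rotationAverage hD hDK θ
  have hHε : ∀ x, ε ≤ rotationAverage f θ x := le_rotationAverage hfc hfK hεf θ
  have hHK : ∀ x, |rotationAverage f θ x| ≤ K := fun x =>
    norm_rotationAverage_le (g := f) hfK θ x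
  have hGK : ∀ x, ‖rotationAverage D θ x‖ ≤ K := norm_rotationAverage_le hDK θ
  have hH0 : ∀ x, rotationAverage f θ x ≠ 0 := fun x => (hε.trans_le (hHε x)).ne'
  have hlogc : Continuous fun x => Real.log (rotationAverage f θ x) := hHc.log hH0
  set C := |Real.log ε| + |Real.log K| with hC
  have hlog : ∀ x, |Real.log (rotationAverage f θ x)| ≤ C := fun x =>
    abs_log_le_of_mem hε (hHε x) ((le_abs_self _).trans (hHK x))
  have hC0 : 0 ≤ C := by positivity
  have hK0 : 0 ≤ K := (abs_nonneg _).trans (hfK 0)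
  have hlog1 : ∀ x, |Real.log (rotationAverage f θ x) + 1| ≤ C + 1 := fun x =>
    (abs_add_le _ _).trans (by rw [abs_one]; gcongr; exact hlog x)
  have hdiv : ∀ x, |1 / rotationAverage f θ x| ≤ 1 / ε := fun x => by
    rw [abs_of_pos (one_div_pos.2 (hε.trans_le (hHε x)))]
    exact one_div_le_one_div_of_le hε (hHε x)
  set γ := stdGaussian E
  set H := rotationAverage f θ
  set G := rotationAverage D θ
  set c := Real.cos θ
  set s := Real.sin θ
  have hrot : MeasurePreserving (fun p : E × E => (c • p.1 + s • p.2, -s • p.1 + c • p.2))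
      (γ.prod γ) (γ.prod γ) := measurePreserving_rotation_stdGaussian θ
  have hcs : c ^ 2 + s ^ 2 = 1 := Real.cos_sq_add_sin_sq θ
  -- The inverse rotation recovers `x = c u - s v`.
  have hback : ∀ p : E × E, c • (c • p.1 + s • p.2) - s • (-s • p.1 + c • p.2) = p.1 := by
    intro p
    have : c • (c • p.1 + s • p.2) - s • (-s • p.1 + c • p.2) = (c ^ 2 + s ^ 2) • p.1 := by
      module
    rw [this, hcs, one_smul]
  have hHc' : Continuous fun q : E × E => Real.log (H (c • q.1 - s • q.2)) :=
    hlogc.comp (by fun_prop)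
  have hinv : Continuous fun x => 1 / H x := continuous_const.div hHc hH0
  -- first rotation
  have int1 : Integrable (fun q : E × E =>
      (Real.log (H (c • q.1 - s • q.2)) + 1) * inner ℝ (D q.1) q.2) (γ.prod γ) := by
    refine Integrable.mono' (g := fun q : E × E => (C + 1) * (K * ‖q.2‖)) ?_
      (by fun_prop) (.of_forall fun q => ?_)
    · exact ((integrable_norm_stdGaussian.comp_snd γ).const_mul K).const_mul _
    · rw [norm_mul]
      gcongr
      · exact hlog1 _
      · exact (norm_inner_le_norm _ _).trans (by gcongr; exact hDK _)
  have int1' : Integrable (fun p : E × E =>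
      (Real.log (H p.1) + 1) * inner ℝ (D (c • p.1 + s • p.2)) (-s • p.1 + c • p.2))
      (γ.prod γ) := by
    have := hrot.integrable_comp_of_integrable int1
    simpa only [Function.comp_def, hback] using this
  have e1 : ∫ x, (Real.log (H x) + 1) * rotationAverageDeriv D θ x ∂γ
      = ∫ u, ∫ v, (Real.log (H (c • u - s • v)) + 1) * inner ℝ (D u) v ∂γ ∂γ := by
    rw [← integral_prod _ int1]
    nth_rewrite 1 [← hrot.map_eq]
    rw [integral_map hrot.measurable.aemeasurable (by
      rw [hrot.map_eq]; exact int1.aestronglyMeasurable)]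
    simp_rw [hback]
    rw [integral_prod _ int1']
    simp_rw [integral_const_mul]
    rfl
  -- integration by parts
  have e2 : ∀ u, ∫ v, (Real.log (H (c • u - s • v)) + 1) * inner ℝ (D u) v ∂γ
      = ∫ v, -(s * c) * (1 / H (c • u - s • v) * inner ℝ (G (c • u - s • v)) (D u)) ∂γ := by
    intro u
    -- The factor `-s` comes from the dependence of `c u - s v` on `v`, the factor `c` from the
    -- gradient of `H`, which is `c G`.
    have hgrad : ∀ v, HasGradientAt (fun v => Real.log (H (c • u - s • v)) + 1)
        ((-(s * c) * (1 / H (c • u - s • v))) • G (c • u - s • v)) v := by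
      intro v
      have h1 : HasFDerivAt (fun v : E => c • u - s • v) (-(s • ContinuousLinearMap.id ℝ E)) v := by
        simpa using ((hasFDerivAt_id v).const_smul s).const_sub (c • u)
      have h2 := (hasGradientAt_rotationAverage hf hD hfK hDK θ (c • u - s • v)).hasFDerivAt
      have h3 := ((h2.comp v h1).log (hH0 (c • u - s • v))).add_const 1
      refine HasFDerivAt.congr_fderiv h3 ?_
      ext z
      simp
      ring
    rw [integral_mul_inner_stdGaussian (C := max (C + 1) (|s * c| * (1 / ε) * K)) hgrad
      (fun v => (hlog1 _).trans (le_max_left _ _)) (fun v => le_trans ?_ (le_max_right _ _))]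
    · refine integral_congr_ae (.of_forall fun v => ?_)
      simp only [inner_smul_left]
      simp
      ring
    · rw [norm_smul, norm_mul, norm_neg]
      exact mul_le_mul (mul_le_mul le_rfl (hdiv _) (norm_nonneg _) (abs_nonneg _)) (hGK _)
        (norm_nonneg _) (by positivity)
  -- second rotation
  have hHc2 : Continuous fun q : E × E => 1 / H (c • q.1 - s • q.2) := hinv.comp (by fun_prop)
  have hGc2 : Continuous fun q : E × E => G (c • q.1 - s • q.2) := hGc.comp (by fun_prop)
  have int2 : Integrable (fun q : E × E => -(s * c) *
      (1 / H (c • q.1 - s • q.2) * inner ℝ (G (c • q.1 - s • q.2)) (D q.1))) (γ.prod γ) := by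
    refine Integrable.const_mul (Integrable.mono' (g := fun q : E × E => (1 / ε) * (K * K))
      (integrable_const _) (by fun_prop) (.of_forall fun q => ?_)) _
    rw [norm_mul]
    gcongr
    · exact hdiv _
    · exact (norm_inner_le_norm _ _).trans (by gcongr; exacts [hGK _, hDK _])
  have int2' : Integrable (fun p : E × E => -(s * c) *
      (1 / H p.1 * inner ℝ (G p.1) (D (c • p.1 + s • p.2)))) (γ.prod γ) := by
    have := hrot.integrable_comp_of_integrable int2
    simpa only [Function.comp_def, hback] using this
  have e3 : ∫ u, ∫ v, -(s * c) * (1 / H (c • u - s • v) * inner ℝ (G (c • u - s • v)) (D u)) ∂γ ∂γ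
      = ∫ x, -(s * c) * (‖G x‖ ^ 2 / H x) ∂γ := by
    rw [← integral_prod _ int2]
    nth_rewrite 1 [← hrot.map_eq]
    rw [integral_map hrot.measurable.aemeasurable (by
      rw [hrot.map_eq]; exact int2.aestronglyMeasurable)]
    simp_rw [hback]
    rw [integral_prod _ int2']
    refine integral_congr_ae (.of_forall fun x => ?_)
    simp only
    -- With `x` fixed, averaging `D (c x + s y)` over `y` gives `G x`, so the inner product becomes
    -- `‖G x‖²`.
    rw [integral_const_mul, integral_const_mul, integral_inner
      (integrable_of_continuous_bounded (by fun_prop) fun y => hDK _)]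
    change -(s * c) * (1 / H x * inner ℝ (G x) (G x)) = _
    rw [real_inner_self_eq_norm_sq]
    ring
  rw [e1, ← integral_const_mul, ← e3]
  exact integral_congr_ae (.of_forall e2)

/-- Contraction of the Fisher information under rotation averages. -/
theorem integral_norm_sq_div_rotationAverage_le (hfc : Continuous f)
    (hD : Continuous D) (hε : 0 < ε) (hεf : ∀ x, ε ≤ f x)
    (hfK : ∀ x, |f x| ≤ K) (hDK : ∀ x, ‖D x‖ ≤ K) (θ : ℝ) :
    ∫ x, ‖rotationAverage D θ x‖ ^ 2 / rotationAverage f θ x ∂(stdGaussian E)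
      ≤ ∫ x, ‖D x‖ ^ 2 / f x ∂(stdGaussian E) := by
  have hHc : Continuous (rotationAverage f θ) := continuous_rotationAverage hfc hfK θ
  have hGc : Continuous (rotationAverage D θ) := continuous_rotationAverage hD hDK θ
  have hHε : ∀ x, ε ≤ rotationAverage f θ x := le_rotationAverage hfc hfK hεf θ
  have hGK : ∀ x, ‖rotationAverage D θ x‖ ≤ K := norm_rotationAverage_le hDK θ
  have hH0 : ∀ x, rotationAverage f θ x ≠ 0 := fun x => (hε.trans_le (hHε x)).ne'
  have hf0 : ∀ x, f x ≠ 0 := fun x => (hε.trans_le (hεf x)).ne'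
  have hq : Continuous fun x => ‖D x‖ ^ 2 / f x := (by fun_prop : Continuous fun x =>
    ‖D x‖ ^ 2).div hfc hf0
  have hqK : ∀ x, ‖‖D x‖ ^ 2 / f x‖ ≤ K ^ 2 / ε := fun x => by
    rw [Real.norm_of_nonneg (div_nonneg (by positivity) (hε.le.trans (hεf x)))]
    gcongr
    exacts [hDK x, hεf x]
  set γ := stdGaussian E
  have hrot := measurePreserving_rotation_stdGaussian (E := E) θ
  have hint : Integrable (fun q : E × E => ‖D q.1‖ ^ 2 / f q.1) (γ.prod γ) :=
    (integrable_of_continuous_bounded (μ := γ) hq hqK).comp_fst γ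
  -- By rotation invariance, `cos θ x + sin θ y` is again standard Gaussian.
  have e : ∫ x, ‖D x‖ ^ 2 / f x ∂γ
      = ∫ x, rotationAverage (fun x => ‖D x‖ ^ 2 / f x) θ x ∂γ := by
    have h1 : ∫ x, ‖D x‖ ^ 2 / f x ∂γ = ∫ q : E × E, ‖D q.1‖ ^ 2 / f q.1 ∂(γ.prod γ) := by
      rw [integral_prod _ hint]; simp
    rw [h1]
    nth_rewrite 1 [← hrot.map_eq]
    rw [integral_map hrot.measurable.aemeasurable (by
      rw [hrot.map_eq]; exact hint.aestronglyMeasurable)]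
    exact integral_prod _ (hrot.integrable_comp_of_integrable hint)
  rw [e]
  refine integral_mono (integrable_of_continuous_bounded (K := K ^ 2 / ε)
    ((by fun_prop : Continuous fun x => ‖rotationAverage D θ x‖ ^ 2).div hHc hH0) fun x => ?_)
    (integrable_of_continuous_bounded (K := K ^ 2 / ε) (continuous_rotationAverage hq hqK θ)
      (norm_rotationAverage_le hqK θ)) fun x => ?_
  · rw [Real.norm_of_nonneg (div_nonneg (by positivity) (hε.le.trans (hHε x)))]
    gcongr
    exacts [hGK x, hHε x]
  -- Joint convexity of `(d, a) ↦ ‖d‖² / a`, in the form of its supporting affine functions. Being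
  -- linear in `(D, f)`, they commute with averaging; `b = G / H` below is the slope that is optimal
  -- for the averages.
  · have hpt : ∀ (b z : E), 2 * inner ℝ b (D z) - f z * ‖b‖ ^ 2 ≤ ‖D z‖ ^ 2 / f z := by
      intro b z
      have hz := hε.trans_le (hεf z)
      rw [le_div_iff₀ hz]
      have h1 := real_inner_self_nonneg (x := D z - f z • b)
      rw [inner_sub_left, inner_sub_right, inner_sub_right, inner_smul_left, inner_smul_right,
        inner_smul_right, inner_smul_left, real_inner_self_eq_norm_sq, real_inner_self_eq_norm_sq,
        real_inner_comm b] at h1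
      simp only [conj_trivial] at h1
      nlinarith
    set b : E := (rotationAverage f θ x)⁻¹ • rotationAverage D θ x with hb
    have hDi : Integrable (fun y => D (Real.cos θ • x + Real.sin θ • y)) γ :=
      integrable_of_continuous_bounded (by fun_prop) fun y => hDK _
    have hfi : Integrable (fun y => f (Real.cos θ • x + Real.sin θ • y)) γ :=
      integrable_of_continuous_bounded (by fun_prop) fun y => hfK _
    have h2 := integral_mono (μ := γ)
      (((hDi.const_inner b).const_mul 2).sub (hfi.mul_const (‖b‖ ^ 2)))
      (integrable_of_continuous_bounded (hq.comp (by fun_prop :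
        Continuous fun y => Real.cos θ • x + Real.sin θ • y)) fun y => hqK _)
      fun y => hpt b (Real.cos θ • x + Real.sin θ • y)
    refine le_trans (le_of_eq ?_) h2
    simp only [Pi.sub_apply]
    rw [integral_sub ((hDi.const_inner b).const_mul 2) (hfi.mul_const (‖b‖ ^ 2)),
      integral_const_mul, integral_mul_const, integral_inner hDi]
    change _ = 2 * inner ℝ b (rotationAverage D θ x) - rotationAverage f θ x * ‖b‖ ^ 2
    rw [hb, inner_smul_left, real_inner_self_eq_norm_sq, norm_smul, mul_pow, norm_inv,
      Real.norm_eq_abs, inv_pow, sq_abs]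
    have := hH0 x
    simp
    field_simp
    ring

/-- The logarithmic Sobolev inequality of the standard Gaussian measure, for functions that are
bounded, bounded away from `0`, and have a bounded continuous gradient. -/
theorem integral_klFun_stdGaussian_le (hf : ∀ x, HasGradientAt f (D x) x)
    (hD : Continuous D) (hε : 0 < ε) (hεf : ∀ x, ε ≤ f x)
    (hfK : ∀ x, |f x| ≤ K) (hDK : ∀ x, ‖D x‖ ≤ K) :
    ∫ x, InformationTheory.klFun (f x) ∂(stdGaussian E)
      ≤ InformationTheory.klFun (∫ x, f x ∂(stdGaussian E))
        + 1 / 2 * ∫ x, ‖D x‖ ^ 2 / f x ∂(stdGaussian E) := by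
  have hfc : Continuous f := continuous_iff_continuousAt.2 fun x => (hf x).continuousAt
  set γ := stdGaussian E
  set J := ∫ x, ‖D x‖ ^ 2 / f x ∂γ
  set ψ : ℝ → ℝ := fun θ => ∫ x, rotationAverage f θ x * Real.log (rotationAverage f θ x) ∂γ
  -- The added term has derivative `sin θ cos θ J`, which dominates the entropy loss because the
  -- Fisher information of the average is at most `J`.
  have hderiv : ∀ θ, HasDerivAt (fun θ => ψ θ + 1 / 2 * Real.sin θ ^ 2 * J)
      (-(Real.sin θ * Real.cos θ) *
        (∫ x, ‖rotationAverage D θ x‖ ^ 2 / rotationAverage f θ x ∂γ)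
        + Real.sin θ * Real.cos θ * J) θ := by
    intro θ
    have h1 := hasDerivAt_entropy_rotationAverage hf hD hε hεf hfK hDK θ
    rw [integral_log_mul_rotationAverageDeriv hf hD hε hεf hfK hDK] at h1
    have h2 := (((Real.hasDerivAt_sin θ).pow 2).const_mul (1 / 2)).mul_const J
    convert! h1.add h2 using 1
    ring
  have hmono : MonotoneOn (fun θ => ψ θ + 1 / 2 * Real.sin θ ^ 2 * J)
      (Set.Icc 0 (Real.pi / 2)) := by
    refine monotoneOn_of_deriv_nonneg (convex_Icc _ _)
      (fun θ _ => (hderiv θ).continuousAt.continuousWithinAt)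
      (fun θ _ => (hderiv θ).differentiableAt.differentiableWithinAt) fun θ hθ => ?_
    rw [interior_Icc] at hθ
    rw [(hderiv θ).deriv]
    have h1 : 0 ≤ Real.sin θ * Real.cos θ :=
      mul_nonneg (Real.sin_nonneg_of_nonneg_of_le_pi hθ.1.le (by linarith [hθ.2, Real.pi_pos]))
        (Real.cos_nonneg_of_mem_Icc ⟨by linarith [hθ.1, Real.pi_pos], hθ.2.le⟩)
    have h2 := integral_norm_sq_div_rotationAverage_le hfc hD hε hεf hfK hDK θ
    nlinarith
  -- At `θ = 0` the average is `f` itself, at `θ = π/2` it is the mean of `f`.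
  have h := hmono (Set.left_mem_Icc.2 (by positivity)) (Set.right_mem_Icc.2 (by positivity))
    (by positivity)
  have hfi : Integrable f γ := integrable_of_continuous_bounded hfc hfK
  have hf0 : ∀ x, f x ≠ 0 := fun x => (hε.trans_le (hεf x)).ne'
  have hli : Integrable (fun x => f x * Real.log (f x)) γ := by
    refine integrable_of_continuous_bounded (K := K * (|Real.log ε| + |Real.log K|))
      (hfc.mul (hfc.log hf0)) fun x => ?_
    rw [norm_mul]
    have := (abs_nonneg _).trans (hfK x)
    gcongr
    · exact hfK x
    · exact abs_log_le_of_mem hε (hεf x) ((le_abs_self _).trans (hfK x))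
  simp [ψ, rotationAverage] at h
  simp only [InformationTheory.klFun_apply]
  have hsum : ∫ x, (f x * Real.log (f x) + 1 - f x) ∂γ
      = ∫ x, f x * Real.log (f x) ∂γ + 1 - ∫ x, f x ∂γ := by
    refine (integral_sub (hli.add (integrable_const 1)) hfi).trans ?_
    congr 1
    exact (integral_add hli (integrable_const 1)).trans (by simp)
  rw [hsum]
  linarith

end GaussianLSI

/-! ### Mollification and compactly supported weakly differentiable functions -/

section WeakGradient

open Filter Topology InformationTheory
open scoped Convolution

variable {E : Type*} [NormedAddCommGroup E] [InnerProductSpace ℝ E] [FiniteDimensional ℝ E]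
  [MeasurableSpace E] [BorelSpace E]

/-- The logarithmic Sobolev inequality, in entropy form and with constant `c`, for the functions
`ε + u` with `ε > 0` and `u ≥ 0` continuously differentiable with compact support. -/
def SmoothLSI (ν : Measure E) (c : ℝ) : Prop :=
  ∀ (u : E → ℝ) (D : E → E) (ε : ℝ), 0 < ε → (∀ x, 0 ≤ u x) → HasCompactSupport u →
    (∀ x, HasGradientAt u (D x) x) → Continuous D →
    ∫ x, klFun (ε + u x) ∂ν ≤ klFun (∫ x, (ε + u x) ∂ν) + c * ∫ x, ‖D x‖ ^ 2 / (ε + u x) ∂ν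

/-- Convolution of `w` with a normed bump function. -/
noncomputable def mollify {G : Type*} [NormedAddCommGroup G] [NormedSpace ℝ G]
    (φ : ContDiffBump (0 : E)) (w : E → G) (x : E) : G :=
  ∫ t, φ.normed volume (x - t) • w t

section

variable {G : Type*} [NormedAddCommGroup G] [NormedSpace ℝ G]

theorem mollify_eq_convolution (φ : ContDiffBump (0 : E)) (w : E → G) :
    mollify φ w = (φ.normed volume ⋆[ContinuousLinearMap.lsmul ℝ ℝ, volume] w) := by
  ext x; rw [convolution_lsmul_swap]; rfl

theorem hasCompactSupport_normed_comp_sub (φ : ContDiffBump (0 : E)) (x : E) :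
    HasCompactSupport fun t => φ.normed volume (x - t) :=
  (φ.hasCompactSupport_normed (μ := volume)).comp_homeomorph (Homeomorph.subLeft x)

theorem integrable_mollify_integrand (φ : ContDiffBump (0 : E)) {w : E → G}
    (hw : LocallyIntegrable w) (x : E) :
    Integrable fun t => φ.normed volume (x - t) • w t :=
  hw.integrable_smul_left_of_hasCompactSupport
    (φ.continuous_normed.comp (continuous_const.sub continuous_id))
    (hasCompactSupport_normed_comp_sub φ x)

theorem continuous_mollify (φ : ContDiffBump (0 : E)) {w : E → G}
    (hw : LocallyIntegrable w) : Continuous (mollify φ w) := by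
  rw [mollify_eq_convolution]
  exact HasCompactSupport.continuous_convolution_left _ φ.hasCompactSupport_normed
    φ.continuous_normed hw

/-- Since the bump function is even, Fubini moves the mollification from `w` to the bounded
continuous `p`. The mollified `p` converges pointwise with bound `C`, so dominated convergence
applies with `w` fixed. -/
theorem integral_smul_mollify_tendsto [CompleteSpace G] {p : E → ℝ} {w : E → G} {C : ℝ}
    {φ : ℕ → ContDiffBump (0 : E)} (hφ : Tendsto (fun i => (φ i).rOut) atTop (𝓝 0))
    (hw : Integrable w) (hp : Continuous p) (hpC : ∀ x, |p x| ≤ C) :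
    Tendsto (fun i => ∫ x, p x • mollify (φ i) w x) atTop (𝓝 (∫ x, p x • w x)) := by
  have hsymm : ∀ i x t, (φ i).normed (volume : Measure E) (x - t) = (φ i).normed volume (t - x) :=
    fun i x t => by rw [← neg_sub t x, ContDiffBump.normed_neg]
  have hpi : LocallyIntegrable p := hp.locallyIntegrable
  have h1 : ∀ i, ∫ x, p x • mollify (φ i) w x = ∫ t, mollify (φ i) p t • w t := by
    intro i
    have hint : Integrable (fun q : E × E => p q.1 • ((φ i).normed volume (q.1 - q.2) • w q.2))
        (volume.prod volume) := by
      have h := (hw.convolution_integrand (ContinuousLinearMap.lsmul ℝ ℝ).flip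
        ((φ i).integrable_normed (μ := volume)))
      exact h.bdd_smul C (φ := fun q : E × E => p q.1)
        (hp.comp continuous_fst).aestronglyMeasurable (.of_forall fun q => hpC q.1)
    have h2 : ∀ x, p x • mollify (φ i) w x
        = ∫ t, p x • ((φ i).normed volume (x - t) • w t) := fun x => (integral_smul _ _).symm
    simp_rw [h2]
    rw [integral_integral_swap hint]
    refine integral_congr_ae (.of_forall fun t => ?_)
    simp only
    rw [mollify, ← integral_smul_const]
    refine integral_congr_ae (.of_forall fun x => ?_)
    simp only [smul_eq_mul]
    rw [hsymm i t x, smul_smul, mul_comm]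
  simp_rw [h1]
  refine tendsto_integral_of_dominated_convergence (fun t => C * ‖w t‖)
    (fun i => ((continuous_mollify (φ i) hpi).aestronglyMeasurable.smul hw.aestronglyMeasurable))
    (hw.norm.const_mul C) (fun i => .of_forall fun t => ?_) (.of_forall fun t => ?_)
  · rw [norm_smul]
    gcongr
    refine (norm_integral_le_of_norm_le
      (((((φ i).integrable_normed (μ := volume)).comp_sub_left t).mul_const C))
      (.of_forall fun s => ?_)).trans (le_of_eq ?_)
    · rw [norm_smul, Real.norm_of_nonneg ((φ i).nonneg_normed _)]
      gcongr
      · exact (φ i).nonneg_normed _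
      · exact hpC s
    · rw [integral_mul_const, integral_sub_left_eq_self (fun s => (φ i).normed volume s) volume t,
        ContDiffBump.integral_normed, one_mul]
  · refine Tendsto.smul_const ?_ _
    have := ContDiffBump.convolution_tendsto_right_of_continuous (μ := (volume : Measure E))
      hφ hp t
    simpa only [← mollify_eq_convolution] using this

end

theorem integral_inner_const {α : Type*} [MeasurableSpace α] {μ : Measure α} {b : α → E}
    (hb : Integrable b μ) (a : E) : ∫ y, inner ℝ (b y) a ∂μ = inner ℝ (∫ y, b y ∂μ) a := by
  rw [real_inner_comm, ← integral_inner hb]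
  simp_rw [real_inner_comm]

/-- The weak gradient commutes with mollification. -/
theorem hasGradientAt_mollify (φ : ContDiffBump (0 : E)) {w : E → ℝ} {b : E → E}
    (hw : LocallyIntegrable w) (hb : LocallyIntegrable b)
    (hweak : ∀ ψ : E → ℝ, ContDiff ℝ ((⊤ : ℕ∞) : WithTop ℕ∞) ψ → HasCompactSupport ψ →
      ∀ a : E, ∫ y, w y * fderiv ℝ ψ y a = - ∫ y, inner ℝ (b y) a * ψ y) (x : E) :
    HasGradientAt (mollify φ w) (mollify φ b x) x := by
  have hφs : ContDiff ℝ ((⊤ : ℕ∞) : WithTop ℕ∞) (φ.normed (volume : Measure E)) :=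
    φ.contDiff_normed
  have hφ1 : ContDiff ℝ 1 (φ.normed (volume : Measure E)) := φ.contDiff_normed (n := 1)
  have h := φ.hasCompactSupport_normed.hasFDerivAt_convolution_left
    (ContinuousLinearMap.lsmul ℝ ℝ) hφ1 hw x
  rw [mollify_eq_convolution]
  refine HasFDerivAt.congr_fderiv h ?_
  ext a
  have hfdc : Continuous (fderiv ℝ (φ.normed (volume : Measure E))) :=
    hφ1.continuous_fderiv (by norm_num)
  have hint : Integrable fun t => w t • fderiv ℝ (φ.normed (volume : Measure E)) (x - t) :=
    hw.integrable_smul_right_of_hasCompactSupport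
      (hfdc.comp (continuous_const.sub continuous_id))
      ((φ.hasCompactSupport_normed.fderiv ℝ).comp_homeomorph (Homeomorph.subLeft x))
  have e1 : (fderiv ℝ (φ.normed (volume : Measure E)) ⋆[(ContinuousLinearMap.lsmul ℝ ℝ).precompL E,
      volume] w) x = ∫ t, w t • fderiv ℝ (φ.normed (volume : Measure E)) (x - t) := by
    rw [convolution_eq_swap]
    refine integral_congr_ae (.of_forall fun t => ?_)
    ext z
    simp [ContinuousLinearMap.precompL_apply, mul_comm]
  rw [e1, ContinuousLinearMap.integral_apply hint]
  have hder : ∀ t, fderiv ℝ (fun t => φ.normed (volume : Measure E) (x - t)) t a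
      = - fderiv ℝ (φ.normed (volume : Measure E)) (x - t) a := by
    intro t
    have h1 : HasFDerivAt (fun t : E => x - t) (-ContinuousLinearMap.id ℝ E) t := by
      simpa using (hasFDerivAt_id t).const_sub x
    have h2 := ((hφ1.differentiable (by norm_num)) (x - t)).hasFDerivAt.comp t h1
    have h3 : fderiv ℝ (fun t => φ.normed (volume : Measure E) (x - t)) t
      = (fderiv ℝ (φ.normed (volume : Measure E)) (x - t)).comp (-ContinuousLinearMap.id ℝ E) :=
      h2.fderiv
    rw [h3]; simp
  have hwk := hweak (fun t => φ.normed volume (x - t))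
    (hφs.comp (contDiff_const.sub contDiff_id)) (hasCompactSupport_normed_comp_sub φ x) a
  simp_rw [hder, mul_neg, integral_neg, neg_inj] at hwk
  simp only [_root_.smul_apply, smul_eq_mul]
  rw [hwk]
  simp only [InnerProductSpace.toDual_apply_apply]
  rw [mollify, ← integral_inner_const (integrable_mollify_integrand φ hb x)]
  refine integral_congr_ae (.of_forall fun t => ?_)
  simp [inner_smul_left, mul_comm]

theorem integral_withDensity_ofReal {p : E → ℝ} (hp : Continuous p) (hp0 : ∀ x, 0 < p x)
    (f : E → ℝ) :
    ∫ x, f x ∂(volume.withDensity fun x => ENNReal.ofReal (p x)) = ∫ x, p x * f x := by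
  rw [integral_withDensity_eq_integral_toReal_smul (by fun_prop) (by simp)]
  simp [ENNReal.toReal_ofReal (hp0 _).le]

theorem integrable_withDensity_ofReal_iff {p : E → ℝ} (hp : Continuous p) (hp0 : ∀ x, 0 < p x)
    {f : E → ℝ} :
    Integrable f (volume.withDensity fun x => ENNReal.ofReal (p x))
      ↔ Integrable fun x => p x * f x := by
  rw [integrable_withDensity_iff_integrable_smul' (by fun_prop) (by simp)]
  simp [ENNReal.toReal_ofReal (hp0 _).le]

/-- Lower semicontinuity of the entropy. -/
theorem lintegral_klFun_le_of_tendsto {ν : Measure E} {f : ℕ → E → ℝ} {g : E → ℝ} {r : ℕ → ℝ≥0∞}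
    {s : ℝ≥0∞} (hf : ∀ n, AEMeasurable (f n) ν)
    (hfg : ∀ᵐ x ∂ν, Tendsto (fun n => f n x) atTop (𝓝 (g x)))
    (hr : ∀ n, ∫⁻ x, ENNReal.ofReal (klFun (f n x)) ∂ν ≤ r n) (hs : Tendsto r atTop (𝓝 s)) :
    ∫⁻ x, ENNReal.ofReal (klFun (g x)) ∂ν ≤ s := by
  have h1 : ∫⁻ x, ENNReal.ofReal (klFun (g x)) ∂ν
      = ∫⁻ x, liminf (fun n => ENNReal.ofReal (klFun (f n x))) atTop ∂ν := by
    refine lintegral_congr_ae ?_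
    filter_upwards [hfg] with x hx
    exact (Tendsto.liminf_eq ((ENNReal.continuous_ofReal.tendsto _).comp
      ((continuous_klFun.tendsto _).comp hx))).symm
  rw [h1]
  refine (lintegral_liminf_le' fun n => (measurable_klFun.comp_aemeasurable (hf n)).ennreal_ofReal).trans ?_
  rw [← hs.liminf_eq]
  exact liminf_le_liminf (.of_forall hr)

/-- The logarithmic Sobolev inequality for `ε + w` where `w` is compactly supported with weak
gradient `b`, and the Fisher information is controlled by `q`. -/
theorem SmoothLSI.lintegral_klFun_le_of_hasCompactSupport {p : E → ℝ} {c C ε : ℝ}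
    (hp : Continuous p) (hp0 : ∀ x, 0 < p x) (hpC : ∀ x, |p x| ≤ C)
    [IsProbabilityMeasure (volume.withDensity fun x => ENNReal.ofReal (p x))]
    (hν : SmoothLSI (volume.withDensity fun x => ENNReal.ofReal (p x)) c) (hc : 0 ≤ c)
    (hε : 0 < ε) {w q : E → ℝ} {b : E → E} (hw0 : ∀ x, 0 ≤ w x)
    (hw : Integrable w) (hq : Integrable q) (hb : Integrable b)
    (hwc : HasCompactSupport w)
    (hweak : ∀ ψ : E → ℝ, ContDiff ℝ ((⊤ : ℕ∞) : WithTop ℕ∞) ψ → HasCompactSupport ψ →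
      ∀ a : E, ∫ y, w y * fderiv ℝ ψ y a = - ∫ y, inner ℝ (b y) a * ψ y)
    (hbq : ∀ y d, 2 * inner ℝ (b y) d ≤ q y + w y * ‖d‖ ^ 2) :
    ∫⁻ x, ENNReal.ofReal (klFun (ε + w x)) ∂(volume.withDensity fun x => ENNReal.ofReal (p x))
      ≤ ENNReal.ofReal (klFun (ε + ∫ x, p x * w x) + c * ∫ x, p x * q x) := by
  set ν := volume.withDensity fun x => ENNReal.ofReal (p x) with hνdef
  -- The ratio of outer to inner radius stays equal to `2`, as Lebesgue differentiation requires for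
  -- almost everywhere convergence of the mollifications.
  let φ : ℕ → ContDiffBump (0 : E) := fun n =>
    ⟨1 / ((n : ℝ) + 1), 2 / ((n : ℝ) + 1), by positivity, by gcongr; norm_num⟩
  have hφ : Tendsto (fun i => (φ i).rOut) atTop (𝓝 0) := by
    have := (tendsto_one_div_add_atTop_nhds_zero_nat (𝕜 := ℝ)).const_mul 2
    simpa only [φ, mul_one_div, mul_zero] using this
  have hwl := hw.locallyIntegrable
  have hql := hq.locallyIntegrable
  have hbl := hb.locallyIntegrable
  have hu0 : ∀ n x, 0 ≤ mollify (φ n) w x := fun n x =>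
    integral_nonneg fun t => smul_nonneg ((φ n).nonneg_normed _) (hw0 t)
  have huc : ∀ n, Continuous (mollify (φ n) w) := fun n => continuous_mollify _ hwl
  have hqc : ∀ n, Continuous (mollify (φ n) q) := fun n => continuous_mollify _ hql
  have hbc : ∀ n, Continuous (mollify (φ n) b) := fun n => continuous_mollify _ hbl
  have hus : ∀ n, HasCompactSupport (mollify (φ n) w) := fun n => by
    rw [mollify_eq_convolution]
    exact (φ n).hasCompactSupport_normed.convolution _ hwc
  have hpos : ∀ n x, 0 < ε + mollify (φ n) w x := fun n x => by linarith [hu0 n x]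
  -- The hypothesis `hbq` is the bound `‖b‖² / w ≤ q` written linearly in `(b, q, w)`, so it
  -- survives mollification. Taking `d = B / (ε + U)` then recovers the quadratic form, the
  -- regularization `ε` only helping.
  have hpt : ∀ n x, ‖mollify (φ n) b x‖ ^ 2 / (ε + mollify (φ n) w x) ≤ mollify (φ n) q x := by
    intro n x
    set B := mollify (φ n) b x with hB
    have hkey : ∀ d, 2 * inner ℝ B d ≤ mollify (φ n) q x + mollify (φ n) w x * ‖d‖ ^ 2 := by
      intro d
      have i1 := integrable_mollify_integrand (φ n) hbl x
      have i2 := integrable_mollify_integrand (φ n) hql x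
      have i3 := integrable_mollify_integrand (φ n) hwl x
      have := integral_mono ((i1.inner_const d).const_mul 2) (i2.add (i3.mul_const (‖d‖ ^ 2)))
        fun t => (by
          have h1 := hbq t d
          have h2 := (φ n).nonneg_normed (μ := (volume : Measure E)) (x - t)
          simp only [inner_smul_left, Pi.add_apply, smul_eq_mul, conj_trivial]
          nlinarith)
      rw [integral_const_mul, integral_inner_const i1, integral_add' i2 (i3.mul_const _),
        integral_mul_const] at this
      exact this
    set U := mollify (φ n) w x
    have hU := hpos n x
    have hU0 := hu0 n x
    have h1 := hkey ((ε + U)⁻¹ • B)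
    rw [inner_smul_right, real_inner_self_eq_norm_sq, norm_smul, mul_pow, norm_inv,
      Real.norm_of_nonneg hU.le] at h1
    have h2 : U * ((ε + U)⁻¹ ^ 2 * ‖B‖ ^ 2) ≤ ‖B‖ ^ 2 / (ε + U) := by
      have : U * ((ε + U)⁻¹ ^ 2 * ‖B‖ ^ 2) = (U / (ε + U)) * (‖B‖ ^ 2 / (ε + U)) := by
        field_simp
      rw [this]
      refine mul_le_of_le_one_left (by positivity) ?_
      rw [div_le_one hU]; linarith
    have h3 : 2 * ((ε + U)⁻¹ * ‖B‖ ^ 2) = 2 * (‖B‖ ^ 2 / (ε + U)) := by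
      rw [div_eq_inv_mul]
    linarith
  have hpi : Integrable p := by
    have := (integrable_withDensity_ofReal_iff hp hp0 (f := fun _ => 1)).1 (integrable_const 1)
    simpa using this
  have hub : ∀ n, ∃ M, ∀ x, ‖mollify (φ n) w x‖ ≤ M := fun n =>
    (huc n).bounded_above_of_compact_support (hus n)
  have hui : ∀ n, Integrable (mollify (φ n) w) ν := fun n =>
    integrable_of_continuous_bounded (huc n) (hub n).choose_spec
  have hqi : ∀ n, Integrable (mollify (φ n) q) := fun n => by
    rw [mollify_eq_convolution]
    exact ((φ n).integrable_normed (μ := volume)).integrable_convolution _ hq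
  have hpqi : ∀ n, Integrable (fun x => p x * mollify (φ n) q x) := fun n =>
    (hqi n).bdd_mul (c := C) hp.aestronglyMeasurable (.of_forall hpC)
  refine lintegral_klFun_le_of_tendsto (f := fun n x => ε + mollify (φ n) w x)
    (r := fun n => ENNReal.ofReal (klFun (ε + ∫ x, p x * mollify (φ n) w x)
      + c * ∫ x, p x * mollify (φ n) q x))
    (fun n => by have := huc n; fun_prop) ?_ (fun n => ?_) ?_
  · have h := ContDiffBump.ae_convolution_tendsto_right_of_locallyIntegrable (K := 2)
      (μ := (volume : Measure E)) hφ (.of_forall fun n => by simp [φ]; field_simp; rfl) hwl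
    refine (withDensity_absolutelyContinuous volume _) ?_
    filter_upwards [h] with x hx
    have hx' : Tendsto (fun n => mollify (φ n) w x) atTop (𝓝 (w x)) := by
      simpa only [mollify_eq_convolution] using hx
    exact hx'.const_add ε
  · have hklc : Continuous fun x => klFun (ε + mollify (φ n) w x) :=
      continuous_klFun.comp (continuous_const.add (huc n))
    obtain ⟨M, hM⟩ := hub n
    have hkl : Integrable (fun x => klFun (ε + mollify (φ n) w x)) ν := by
      obtain ⟨M', hM'⟩ := (isCompact_Icc (a := ε) (b := ε + M)).exists_bound_of_continuousOn
        continuous_klFun.continuousOn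
      refine integrable_of_continuous_bounded (K := M') hklc fun x => hM' _ ⟨?_, ?_⟩
      · linarith [hu0 n x]
      · linarith [(le_abs_self _).trans (hM x)]
    rw [← ofReal_integral_eq_lintegral_ofReal hkl (.of_forall fun x => klFun_nonneg (hpos n x).le)]
    refine ENNReal.ofReal_le_ofReal ?_
    refine (hν _ _ ε hε (hu0 n) (hus n)
      (fun x => hasGradientAt_mollify (φ n) hwl hbl hweak x) (hbc n)).trans ?_
    have e1 : ∫ x, (ε + mollify (φ n) w x) ∂ν = ε + ∫ x, p x * mollify (φ n) w x := by
      rw [integral_add (integrable_const _) (hui n), integral_const,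
        integral_withDensity_ofReal hp hp0]
      simp
    rw [e1]
    gcongr
    rw [integral_withDensity_ofReal hp hp0]
    refine integral_mono_of_nonneg (.of_forall fun x => ?_) (hpqi n) (.of_forall fun x => ?_)
    · exact mul_nonneg (hp0 x).le (div_nonneg (by positivity) (hpos n x).le)
    · exact mul_le_mul_of_nonneg_left (hpt n x) (hp0 x).le
  · have h1 := integral_smul_mollify_tendsto hφ hw hp hpC
    have h2 := integral_smul_mollify_tendsto hφ hq hp hpC
    simp only [smul_eq_mul] at h1 h2
    exact (ENNReal.continuous_ofReal.tendsto _).comp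
      (((continuous_klFun.tendsto _).comp (h1.const_add ε)).add (h2.const_mul c))

end WeakGradient

/-! ### From smooth functions to all weakly differentiable densities -/

section WeakLSI

open Filter Topology InformationTheory

variable {E : Type*} [NormedAddCommGroup E] [InnerProductSpace ℝ E] [FiniteDimensional ℝ E]
  [MeasurableSpace E] [BorelSpace E]

/-- Leibniz rule for the weak gradient of `η² h`, for a smooth cutoff function `η`. -/
theorem integral_cutoff_mul_fderiv {h η : E → ℝ} {g D : E → E}
    (hl : LocallyIntegrable h) (hgl : LocallyIntegrable fun x => h x • g x)
    (hη : ContDiff ℝ ((⊤ : ℕ∞) : WithTop ℕ∞) η) (hD : ∀ x, HasGradientAt η (D x) x)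
    (hDc : Continuous D)
    (hweak : ∀ ψ : E → ℝ, ContDiff ℝ ((⊤ : ℕ∞) : WithTop ℕ∞) ψ → HasCompactSupport ψ →
      ∀ a : E, ∫ y, h y * fderiv ℝ ψ y a = - ∫ y, h y * inner ℝ (g y) a * ψ y)
    {ψ : E → ℝ} (hψ : ContDiff ℝ ((⊤ : ℕ∞) : WithTop ℕ∞) ψ) (hψc : HasCompactSupport ψ) (a : E) :
    ∫ y, (η y ^ 2 * h y) * fderiv ℝ ψ y a
      = - ∫ y, inner ℝ ((h y * η y) • (η y • g y + (2 : ℝ) • D y)) a * ψ y := by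
  have hηc : Continuous η := hη.continuous
  have hψcont : Continuous ψ := hψ.continuous
  have hfc : Continuous fun y => fderiv ℝ ψ y a :=
    (hψ.continuous_fderiv (by simp)).clm_apply continuous_const
  have hfs : HasCompactSupport fun y => fderiv ℝ ψ y a :=
    (hψc.fderiv ℝ).comp_left (g := fun L : E →L[ℝ] ℝ => L a) (by simp)
  have h1 := hweak (fun y => η y ^ 2 * ψ y) ((hη.pow 2).mul hψ) hψc.mul_left a
  have hder : ∀ y, fderiv ℝ (fun y => η y ^ 2 * ψ y) y a
      = η y ^ 2 * fderiv ℝ ψ y a + 2 * η y * ψ y * inner ℝ (D y) a := by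
    intro y
    have d1 := ((hD y).hasFDerivAt.pow 2).mul ((hψ.differentiable (by simp)) y).hasFDerivAt
    have d2 : fderiv ℝ (fun y => η y ^ 2 * ψ y) y = _ := d1.fderiv
    rw [d2]
    simp
    ring
  simp_rw [hder] at h1
  have i1 : Integrable fun y => h y • (η y ^ 2 * fderiv ℝ ψ y a) :=
    hl.integrable_smul_right_of_hasCompactSupport (by fun_prop) hfs.mul_left
  have i2 : Integrable fun y => h y • (2 * η y * ψ y * inner ℝ (D y) a) :=
    hl.integrable_smul_right_of_hasCompactSupport (by fun_prop)
      (HasCompactSupport.intro hψc fun y hy => by simp [image_eq_zero_of_notMem_tsupport hy])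
  have i3 : Integrable fun y => h y * inner ℝ (g y) a * (η y ^ 2 * ψ y) := by
    have h2 : Integrable fun y => (η y ^ 2 * ψ y) • (h y • g y) :=
      hgl.integrable_smul_left_of_hasCompactSupport (by fun_prop) hψc.mul_left
    refine (h2.inner_const a).congr (.of_forall fun y => ?_)
    simp only [inner_smul_left, conj_trivial]
    ring
  simp only [smul_eq_mul] at i1 i2
  simp_rw [mul_add] at h1
  rw [integral_add i1 i2] at h1
  have e1 : ∫ y, (η y ^ 2 * h y) * fderiv ℝ ψ y a = ∫ y, h y * (η y ^ 2 * fderiv ℝ ψ y a) := by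
    congr 1; ext y; ring
  have e2 : ∫ y, inner ℝ ((h y * η y) • (η y • g y + (2 : ℝ) • D y)) a * ψ y
      = (∫ y, h y * inner ℝ (g y) a * (η y ^ 2 * ψ y))
        + ∫ y, h y * (2 * η y * ψ y * inner ℝ (D y) a) := by
    rw [← integral_add i3 i2]
    congr 1; ext y
    simp only [inner_smul_left, inner_add_left, conj_trivial]
    ring
  rw [e1, e2]
  linarith

/-- A smooth cutoff sequence, with gradients. -/
theorem exists_cutoff (E : Type*) [NormedAddCommGroup E] [InnerProductSpace ℝ E]
    [FiniteDimensional ℝ E] :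
    ∃ (η : ℕ → E → ℝ) (D : ℕ → E → E) (M : ℝ),
      (∀ n, ContDiff ℝ ((⊤ : ℕ∞) : WithTop ℕ∞) (η n)) ∧ (∀ n, HasCompactSupport (η n)) ∧
      (∀ n x, HasGradientAt (η n) (D n x) x) ∧ (∀ n, Continuous (D n)) ∧
      (∀ n, HasCompactSupport (D n)) ∧
      (∀ n x, 0 ≤ η n x) ∧ (∀ n x, η n x ≤ 1) ∧ (∀ n x, ‖D n x‖ ≤ M) ∧
      (∀ x, Tendsto (fun n => η n x) atTop (𝓝 1)) ∧
      (∀ x, Tendsto (fun n => D n x) atTop (𝓝 0)) := by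
  let f : ContDiffBump (0 : E) := ⟨1, 2, by norm_num, by norm_num⟩
  have hf : ContDiff ℝ ((⊤ : ℕ∞) : WithTop ℕ∞) f := f.contDiff
  have hgrad : ∀ x, HasGradientAt f (gradient f x) x := fun x =>
    ((hf.differentiable (by simp)) x).hasGradientAt
  have hgc : Continuous (gradient f) :=
    (InnerProductSpace.toDual ℝ E).symm.continuous.comp (hf.continuous_fderiv (by simp))
  have hgs : HasCompactSupport (gradient f) :=
    (f.hasCompactSupport.fderiv ℝ).comp_left (g := (InnerProductSpace.toDual ℝ E).symm) (by simp)
  obtain ⟨M, hM⟩ := hgc.bounded_above_of_compact_support hgs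
  -- Dilations of a single bump function; `r n ≤ 1` keeps the gradients uniformly bounded and `r n →
  -- 0` makes them vanish in the limit.
  let r : ℕ → ℝ := fun n => 1 / ((n : ℝ) + 1)
  have hr0 : ∀ n, 0 < r n := fun n => by positivity
  have hr1 : ∀ n, r n ≤ 1 := fun n => by
    simp only [r]; rw [div_le_one (by positivity)]; linarith [Nat.cast_nonneg (α := ℝ) n]
  have hr : Tendsto r atTop (𝓝 0) := tendsto_one_div_add_atTop_nhds_zero_nat
  have hM0 : 0 ≤ M := (norm_nonneg _).trans (hM 0)
  refine ⟨fun n x => f (r n • x), fun n x => r n • gradient f (r n • x), M, ?_, ?_, ?_, ?_, ?_, ?_,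
    ?_, ?_, ?_, ?_⟩
  · exact fun n => hf.comp (contDiff_const_smul _)
  · exact fun n => f.hasCompactSupport.comp_homeomorph (Homeomorph.smulOfNeZero (r n) (hr0 n).ne')
  · intro n x
    have h1 : HasFDerivAt (fun x : E => r n • x) (r n • ContinuousLinearMap.id ℝ E) x :=
      (hasFDerivAt_id x).const_smul _
    refine HasFDerivAt.congr_fderiv ((hgrad _).hasFDerivAt.comp x h1) ?_
    ext a; simp
  · intro n; fun_prop
  · intro n
    have := hgs.comp_homeomorph (Homeomorph.smulOfNeZero (r n) (hr0 n).ne')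
    exact this.smul_left (f := fun _ => r n)
  · exact fun n x => f.nonneg
  · exact fun n x => f.le_one
  · intro n x
    rw [norm_smul, Real.norm_of_nonneg (hr0 n).le]
    calc r n * ‖gradient f (r n • x)‖ ≤ 1 * M :=
          mul_le_mul (hr1 n) (hM _) (norm_nonneg _) zero_le_one
      _ = M := one_mul M
  · intro x
    have h1 : Tendsto (fun n => r n • x) atTop (𝓝 0) := by
      simpa using hr.smul_const x
    have h2 := (f.continuous.tendsto 0).comp h1
    rwa [f.one_of_mem_closedBall (by simp [f])] at h2
  · intro x
    rw [tendsto_zero_iff_norm_tendsto_zero]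
    refine squeeze_zero (fun n => norm_nonneg _) (fun n => ?_) (by simpa using hr.mul_const M)
    rw [norm_smul, Real.norm_of_nonneg (hr0 n).le]
    exact mul_le_mul_of_nonneg_left (hM _) (hr0 n).le

/-- The logarithmic Sobolev inequality for a density with a weak gradient. -/
theorem SmoothLSI.lintegral_klFun_le {p : E → ℝ} {c C : ℝ}
    (hp : Continuous p) (hp0 : ∀ x, 0 < p x) (hpC : ∀ x, |p x| ≤ C)
    [IsProbabilityMeasure (volume.withDensity fun x => ENNReal.ofReal (p x))]
    (hν : SmoothLSI (volume.withDensity fun x => ENNReal.ofReal (p x)) c) (hc : 0 ≤ c)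
    {h : E → ℝ} {g : E → E} (hm : Measurable h) (hgm : Measurable g) (h0 : ∀ x, 0 ≤ h x)
    (hi : Integrable fun x => p x * h x) (h1 : ∫ x, p x * h x = 1)
    (hgi : Integrable fun x => p x * (h x * ‖g x‖ ^ 2))
    (hweak : ∀ ψ : E → ℝ, ContDiff ℝ ((⊤ : ℕ∞) : WithTop ℕ∞) ψ → HasCompactSupport ψ →
      ∀ a : E, ∫ y, h y * fderiv ℝ ψ y a = - ∫ y, h y * inner ℝ (g y) a * ψ y) :
    ∫⁻ x, ENNReal.ofReal (klFun (h x)) ∂(volume.withDensity fun x => ENNReal.ofReal (p x))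
      ≤ ENNReal.ofReal (c * ∫ x, p x * (h x * ‖g x‖ ^ 2)) := by
  obtain ⟨η, D, M, hηs, hηcs, hD, hDc, hDcs, hη0, hη1, hDM, hηlim, hDlim⟩ := exists_cutoff E
  have hloc : ∀ f : E → ℝ, Integrable (fun x => p x * f x) → LocallyIntegrable f := by
    intro f hf
    have h2 := hf.locallyIntegrable.continuous_smul (𝕜 := ℝ) (g := fun x => (p x)⁻¹)
      (hp.inv₀ fun x => (hp0 x).ne')
    refine h2.congr (.of_forall fun x => ?_)
    simp [inv_mul_cancel_left₀ (hp0 x).ne']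
  have hl := hloc _ hi
  have hl2 := hloc _ hgi
  -- From `‖g‖ ≤ 1 + ‖g‖²`.
  have hgl : LocallyIntegrable fun x => h x • g x := by
    refine (hl.add hl2).mono (hm.smul hgm).aestronglyMeasurable (.of_forall fun x => ?_)
    rw [norm_smul, Pi.add_apply, Real.norm_of_nonneg (h0 x),
      Real.norm_of_nonneg (add_nonneg (h0 x) (mul_nonneg (h0 x) (by positivity)))]
    nlinarith [h0 x, sq_nonneg (‖g x‖ - 1), mul_nonneg (h0 x) (sq_nonneg (‖g x‖ - 1)), mul_nonneg (h0 x) (sq_nonneg (‖g x‖))]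
  -- Squaring the cutoff makes the weak gradient `b = h η (η g + 2 ∇η)` divisible by `η`. Hence
  -- `‖b‖² = w q` with `q = h ‖η g + 2 ∇η‖²`, and no division by the cutoff occurs.
  set w : ℕ → E → ℝ := fun n x => η n x ^ 2 * h x with hw
  set k : ℕ → E → E := fun n x => η n x • g x + (2 : ℝ) • D n x with hk
  set q : ℕ → E → ℝ := fun n x => h x * ‖k n x‖ ^ 2 with hq
  set b : ℕ → E → E := fun n x => (h x * η n x) • k n x with hb
  have hηc : ∀ n, Continuous (η n) := fun n => (hηs n).continuous
  have hηm : ∀ n, Measurable (η n) := fun n => (hηc n).measurable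
  have hDm : ∀ n, Measurable (D n) := fun n => (hDc n).measurable
  have hkm : ∀ n, Measurable (k n) := fun n => by have := hηm n; have := hDm n; fun_prop
  have hksq : ∀ n x, ‖k n x‖ ^ 2 ≤ 2 * (η n x ^ 2 * ‖g x‖ ^ 2) + 8 * ‖D n x‖ ^ 2 := by
    intro n x
    have h2 := norm_add_le (η n x • g x) ((2 : ℝ) • D n x)
    rw [norm_smul, norm_smul, Real.norm_of_nonneg (hη0 n x), Real.norm_ofNat] at h2
    have h3 : ‖k n x‖ ^ 2 ≤ (η n x * ‖g x‖ + 2 * ‖D n x‖) ^ 2 := by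
      gcongr
    nlinarith [sq_nonneg (η n x * ‖g x‖ - 2 * ‖D n x‖)]
  have hM0 : 0 ≤ M := (norm_nonneg _).trans (hDM 0 0)
  have hksq' : ∀ n x, ‖k n x‖ ^ 2 ≤ 2 * ‖g x‖ ^ 2 + 8 * M ^ 2 := by
    intro n x
    refine (hksq n x).trans ?_
    gcongr
    · exact mul_le_of_le_one_left (by positivity) (pow_le_one₀ (hη0 n x) (hη1 n x))
    · exact hDM n x
  have hwi : ∀ n, Integrable (w n) := fun n =>
    hl.integrable_smul_left_of_hasCompactSupport (g := fun x => η n x ^ 2) (by have := hηc n; fun_prop)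
      ((hηcs n).comp_left (g := fun t : ℝ => t ^ 2) (by simp))
  have hqi : ∀ n, Integrable (q n) := fun n => by
    have i1 : Integrable fun x => η n x ^ 2 • (h x * ‖g x‖ ^ 2) :=
      hl2.integrable_smul_left_of_hasCompactSupport (g := fun x => η n x ^ 2)
        (by have := hηc n; fun_prop)
        ((hηcs n).comp_left (g := fun t : ℝ => t ^ 2) (by simp))
    have i2 : Integrable fun x => ‖D n x‖ ^ 2 • h x :=
      hl.integrable_smul_left_of_hasCompactSupport (g := fun x => ‖D n x‖ ^ 2)
        (by have := hDc n; fun_prop)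
        ((hDcs n).comp_left (g := fun t : E => ‖t‖ ^ 2) (by simp))
    refine Integrable.mono' ((i1.const_mul 2).add (i2.const_mul 8))
      (hm.mul ((hkm n).norm.pow_const 2)).aestronglyMeasurable (.of_forall fun x => ?_)
    rw [Real.norm_of_nonneg (mul_nonneg (h0 x) (by positivity))]
    simp only [Pi.add_apply, smul_eq_mul]
    nlinarith [mul_le_mul_of_nonneg_left (hksq n x) (h0 x)]
  have hbi : ∀ n, Integrable (b n) := fun n => by
    refine Integrable.mono' ((hqi n).add (hwi n))
      ((hm.mul (hηm n)).smul (hkm n)).aestronglyMeasurable (.of_forall fun x => ?_)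
    rw [norm_smul, Real.norm_of_nonneg (mul_nonneg (h0 x) (hη0 n x))]
    simp only [Pi.add_apply, hq, hw]
    nlinarith [mul_nonneg (h0 x) (sq_nonneg (‖k n x‖ - η n x)),
      mul_nonneg (h0 x) (sq_nonneg (‖k n x‖)), mul_nonneg (h0 x) (sq_nonneg (η n x))]
  have hstep : ∀ n : ℕ, ∫⁻ x, ENNReal.ofReal (klFun (1 / ((n : ℝ) + 1) + w n x))
      ∂(volume.withDensity fun x => ENNReal.ofReal (p x))
      ≤ ENNReal.ofReal (klFun (1 / ((n : ℝ) + 1) + ∫ x, p x * w n x) + c * ∫ x, p x * q n x) := by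
    intro n
    refine hν.lintegral_klFun_le_of_hasCompactSupport hp hp0 hpC hc (by positivity)
      (fun x => mul_nonneg (sq_nonneg _) (h0 x)) (hwi n) (hqi n) (hbi n)
      (((hηcs n).comp_left (g := fun t : ℝ => t ^ 2) (by simp)).mul_right)
      (fun ψ hψ hψc a => integral_cutoff_mul_fderiv hl hgl (hηs n) (hD n) (hDc n) hweak hψ hψc a)
      fun y d => ?_
    -- Multiplied by `h`, the square `‖k - η d‖² ≥ 0` is exactly `2 ⟨b, d⟩ ≤ q + w ‖d‖²`.
    have h2 := real_inner_self_nonneg (x := k n y - η n y • d)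
    rw [inner_sub_left, inner_sub_right, inner_sub_right, inner_smul_left, inner_smul_right,
      inner_smul_right, inner_smul_left, real_inner_self_eq_norm_sq, real_inner_self_eq_norm_sq,
      real_inner_comm (k n y) d] at h2
    simp only [conj_trivial] at h2
    simp only [hb, hq, hw, inner_smul_left, conj_trivial]
    nlinarith [mul_nonneg (h0 y) h2]
  have lim1 : Tendsto (fun n => ∫ x, p x * w n x) atTop (𝓝 1) := by
    rw [← h1]
    refine tendsto_integral_of_dominated_convergence (fun x => p x * h x) (fun n => ?_) hi
      (fun n => .of_forall fun x => ?_) (.of_forall fun x => ?_)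
    · exact (hp.measurable.mul (((hηm n).pow_const 2).mul hm)).aestronglyMeasurable
    · rw [Real.norm_of_nonneg (mul_nonneg (hp0 x).le (mul_nonneg (sq_nonneg _) (h0 x)))]
      exact mul_le_mul_of_nonneg_left
        (mul_le_of_le_one_left (h0 x) (pow_le_one₀ (hη0 n x) (hη1 n x))) (hp0 x).le
    · simpa using (((hηlim x).pow 2).mul_const (h x)).const_mul (p x)
  have lim2 : Tendsto (fun n => ∫ x, p x * q n x) atTop (𝓝 (∫ x, p x * (h x * ‖g x‖ ^ 2))) := by
    refine tendsto_integral_of_dominated_convergence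
      (fun x => 2 * (p x * (h x * ‖g x‖ ^ 2)) + 8 * M ^ 2 * (p x * h x)) (fun n => ?_)
      ((hgi.const_mul 2).add (hi.const_mul _))
      (fun n => .of_forall fun x => ?_) (.of_forall fun x => ?_)
    · exact (hp.measurable.mul (hm.mul ((hkm n).norm.pow_const 2))).aestronglyMeasurable
    · have hph := mul_nonneg (hp0 x).le (h0 x)
      rw [Real.norm_of_nonneg (mul_nonneg (hp0 x).le (mul_nonneg (h0 x) (by positivity)))]
      nlinarith [mul_le_mul_of_nonneg_left (hksq' n x) hph]
    · have h2 : Tendsto (fun n => k n x) atTop (𝓝 (g x)) := by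
        simpa using ((hηlim x).smul_const (g x)).add ((hDlim x).const_smul (2 : ℝ))
      exact ((h2.norm.pow 2).const_mul (h x)).const_mul (p x)
  have lim0 : Tendsto (fun n : ℕ => 1 / ((n : ℝ) + 1)) atTop (𝓝 0) :=
    tendsto_one_div_add_atTop_nhds_zero_nat
  refine lintegral_klFun_le_of_tendsto (f := fun n x => 1 / ((n : ℝ) + 1) + w n x)
    (fun n => ?_) (.of_forall fun x => ?_) hstep ?_
  · have := hηm n
    fun_prop
  · simpa using lim0.add (((hηlim x).pow 2).mul_const (h x))
  · have := (ENNReal.continuous_ofReal.tendsto _).comp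
      (((continuous_klFun.tendsto _).comp (lim0.add lim1)).add (lim2.const_mul c))
    simpa [klFun_one, Function.comp_def] using this

/-- A measure that satisfies the logarithmic Sobolev inequality for smooth functions satisfies it
for all weakly differentiable densities. -/
theorem SmoothLSI.satisfiesLSI {κ : Type*} [Fintype κ] {p : EuclideanSpace ℝ κ → ℝ} {l C : ℝ}
    (hp : Continuous p) (hp0 : ∀ x, 0 < p x) (hpC : ∀ x, |p x| ≤ C)
    [IsProbabilityMeasure (volume.withDensity fun x => ENNReal.ofReal (p x))] (hl : 0 < l)
    (hν : SmoothLSI (volume.withDensity fun x => ENNReal.ofReal (p x)) (l / 2)) :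
    SatisfiesLSI (volume.withDensity fun x => ENNReal.ofReal (p x)) (1 / l) := by
  set ν := (volume : Measure (EuclideanSpace ℝ κ)).withDensity fun x => ENNReal.ofReal (p x)
    with hνdef
  refine ⟨by positivity, fun ζ hζ hac => ?_⟩
  have hconst : (1 / (2 * (1 / l)) : ℝ) = l / 2 := by field_simp
  rw [hconst, fisherInformation, if_pos hac]
  -- The constant is finite and nonzero, so it passes through the infima; this includes the empty
  -- infimum `∞`. It remains to treat one weak logarithmic gradient.
  rw [ENNReal.mul_iInf_of_ne (by simpa using hl) ENNReal.ofReal_ne_top]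
  refine le_iInf fun g => ?_
  rw [ENNReal.mul_iInf' (fun hh => absurd hh ENNReal.ofReal_ne_top) (fun hh => absurd hh (by simpa using hl))]
  refine le_iInf fun hg => ?_
  obtain ⟨hgL, hweak⟩ := hg
  rw [klDiv_eq_lintegral_klFun_of_ac hac]
  set h : EuclideanSpace ℝ κ → ℝ := fun y => (ζ.rnDeriv ν y).toReal with hh
  have hm : Measurable h := (Measure.measurable_rnDeriv ζ ν).ennreal_toReal
  have h0 : ∀ x, 0 ≤ h x := fun x => ENNReal.toReal_nonneg
  have hζν : ζ = ν.withDensity (ζ.rnDeriv ν) := (Measure.withDensity_rnDeriv_eq _ _ hac).symm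
  have hζ' : ζ = ν.withDensity fun x => ENNReal.ofReal (h x) := by
    conv_lhs => rw [hζν]
    refine withDensity_congr_ae ?_
    filter_upwards [Measure.rnDeriv_lt_top ζ ν] with x hx
    rw [hh, ENNReal.ofReal_toReal hx.ne]
  have hζvol : ζ = volume.withDensity fun x => ENNReal.ofReal (p x * h x) := by
    conv_lhs => rw [hζ', hνdef]
    rw [← withDensity_mul _ (by fun_prop) (by fun_prop)]
    congr 1; ext x
    simp [ENNReal.ofReal_mul (hp0 x).le]
  have hint : ∀ {f : EuclideanSpace ℝ κ → ℝ}, Integrable f ζ ↔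
      Integrable fun x => p x * (h x * f x) := by
    intro f
    rw [hζvol, integrable_withDensity_iff_integrable_smul' (by fun_prop) (by simp)]
    refine integrable_congr (.of_forall fun x => ?_)
    simp only [ENNReal.toReal_ofReal (mul_nonneg (hp0 x).le (h0 x)), smul_eq_mul, mul_assoc]
  have hintg : ∀ f : EuclideanSpace ℝ κ → ℝ, ∫ x, f x ∂ζ = ∫ x, p x * (h x * f x) := by
    intro f
    rw [hζvol, integral_withDensity_eq_integral_toReal_smul (by fun_prop) (by simp)]
    refine integral_congr_ae (.of_forall fun x => ?_)
    simp only [ENNReal.toReal_ofReal (mul_nonneg (hp0 x).le (h0 x)), smul_eq_mul, mul_assoc]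
  -- The gradient is determined only `ζ`-almost everywhere, so a measurable version is used. The
  -- products `h g` and `h g'` agree Lebesgue-almost everywhere, because `ζ` has density `p h` and
  -- `p > 0`.
  set g' := hgL.1.mk g with hg'
  have hgm : Measurable g' := hgL.1.stronglyMeasurable_mk.measurable
  have hgg : g =ᵐ[ζ] g' := hgL.1.ae_eq_mk
  have hgg' : ∀ᵐ y ∂(volume : Measure (EuclideanSpace ℝ κ)), h y • g y = h y • g' y := by
    have h2 : ∀ᵐ y ∂ζ, g y = g' y := hgg
    rw [hζvol, ae_withDensity_iff (by fun_prop)] at h2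
    filter_upwards [h2] with y hy
    by_cases hy0 : h y = 0
    · simp [hy0]
    · rw [hy]
      have : 0 < p y * h y := mul_pos (hp0 y) (lt_of_le_of_ne (h0 y) (Ne.symm hy0))
      simpa using this
  have hgL' : MemLp g' 2 ζ := (memLp_congr_ae hgg).1 hgL
  have hsq : Integrable (fun x => ‖g' x‖ ^ 2) ζ := hgL'.integrable_norm_pow (by norm_num)
  have hmain := hν.lintegral_klFun_le hp hp0 hpC (by positivity) hm hgm h0
    (by simpa using hint.1 (integrable_const (1 : ℝ)))
    (by simpa using (hintg fun _ => 1).symm) (hint.1 hsq) (fun ψ hψ hψc a => by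
      rw [hweak ψ hψ hψc a, neg_inj]
      refine integral_congr_ae ?_
      filter_upwards [hgg'] with y hy
      have : h y * inner ℝ (g y) a = h y * inner ℝ (g' y) a := by
        rw [← real_inner_smul_left, hy, real_inner_smul_left]
      change h y * inner ℝ (g y) a * ψ y = _
      rw [this])
  refine hmain.trans (le_of_eq ?_)
  rw [ENNReal.ofReal_mul (by positivity), ← hintg]
  congr 1
  rw [ofReal_integral_eq_lintegral_ofReal hsq (.of_forall fun x => by positivity)]
  refine lintegral_congr_ae ?_
  filter_upwards [hgg] with y hy
  rw [hy, ENNReal.ofReal_pow (norm_nonneg _), ofReal_norm]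

end WeakLSI

/-! ### Transport of the inequality to general Gaussian densities -/

section AffineGaussian

open InformationTheory

variable {E : Type*} [NormedAddCommGroup E] [InnerProductSpace ℝ E] [FiniteDimensional ℝ E]
  [MeasurableSpace E] [BorelSpace E]

/-- An affine image of the standard Gaussian measure has a Gaussian density. -/
theorem exists_map_stdGaussian_eq_withDensity (L : E ≃L[ℝ] E) (m : E) :
    ∃ c : ℝ, 0 < c ∧ (stdGaussian E).map (fun y => m + L.symm y)
      = volume.withDensity fun z => ENNReal.ofReal (c * Real.exp (-(1 / 2) * ‖L (z - m)‖ ^ 2)) := by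
  have hdet : LinearMap.det (L.symm : E →ₗ[ℝ] E) ≠ 0 := L.symm.toLinearEquiv.isUnit_det'.ne_zero
  have hT : Measurable fun y => m + L.symm y := by fun_prop
  have hvol : (volume : Measure E).map (fun y => m + L.symm y)
      = ENNReal.ofReal |(LinearMap.det (L.symm : E →ₗ[ℝ] E))⁻¹| • (volume : Measure E) := by
    have h1 := Measure.map_linearMap_addHaar_eq_smul_addHaar (volume : Measure E) hdet
    have h2 : (fun y => m + L.symm y) = (fun z => m + z) ∘ (L.symm : E →ₗ[ℝ] E) := rfl
    rw [h2, ← Measure.map_map (by fun_prop) (by exact L.symm.continuous.measurable), h1,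
      Measure.map_smul, map_add_left_eq_self]
  set a := |(LinearMap.det (L.symm : E →ₗ[ℝ] E))⁻¹| with ha
  have ha0 : 0 < a := abs_pos.2 (inv_ne_zero hdet)
  set b : ℝ := ((Real.pi / (1 / 2)) ^ (Module.finrank ℝ E / 2 : ℝ))⁻¹ with hb
  have hb0 : 0 < b := by positivity
  refine ⟨a * b, by positivity, ?_⟩
  refine Measure.ext_of_lintegral _ fun f hf => ?_
  rw [lintegral_map hf hT, stdGaussian_eq_withDensity,
    lintegral_withDensity_eq_lintegral_mul _ (by fun_prop) (g := fun y => f (m + L.symm y))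
      (hf.comp hT),
    lintegral_withDensity_eq_lintegral_mul _ (by fun_prop) hf]
  set F : E → ℝ≥0∞ := fun z =>
    ENNReal.ofReal (b * Real.exp (-(1 / 2) * ‖L (z - m)‖ ^ 2)) * f z with hF
  have hFm : Measurable F := by fun_prop
  have e1 : ∫⁻ y, F (m + L.symm y) = ENNReal.ofReal a * ∫⁻ z, F z := by
    rw [← lintegral_map hFm hT, hvol, lintegral_smul_measure, smul_eq_mul]
  refine Eq.trans ?_ (e1.trans ?_)
  · refine lintegral_congr fun y => ?_
    simp [hF, stdGaussianDensity, hb]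
  · rw [← lintegral_const_mul _ hFm]
    refine lintegral_congr fun z => ?_
    simp only [hF, Pi.mul_apply]
    rw [← mul_assoc, ← ENNReal.ofReal_mul ha0.le, mul_assoc a b]

/-- The smooth logarithmic Sobolev inequality for affine images of the standard Gaussian. -/
theorem smoothLSI_map_stdGaussian (T : E →L[ℝ] E) (m : E) {l : ℝ}
    (hT : ∀ w, ‖ContinuousLinearMap.adjoint T w‖ ^ 2 ≤ l * ‖w‖ ^ 2) :
    SmoothLSI ((stdGaussian E).map fun y => m + T y) (l / 2) := by
  intro u D ε hε hu0 hus hD hDc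
  have huc : Continuous u := continuous_iff_continuousAt.2 fun x => (hD x).continuousAt
  have hTm : AEMeasurable (fun y => m + T y) (stdGaussian E) := by fun_prop
  have hpos : ∀ x, 0 < ε + u x := fun x => by linarith [hu0 x]
  obtain ⟨M1, hM1⟩ := huc.bounded_above_of_compact_support hus
  have hDs : HasCompactSupport D := by
    have h1 := (hus.fderiv ℝ).comp_left (g := (InnerProductSpace.toDual ℝ E).symm) (by simp)
    have h2 : D = (InnerProductSpace.toDual ℝ E).symm ∘ fderiv ℝ u := by
      ext1 x; simp [(hD x).hasFDerivAt.fderiv]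
    rw [h2]; exact h1
  obtain ⟨M2, hM2⟩ := hDc.bounded_above_of_compact_support hDs
  have hM20 : 0 ≤ M2 := (norm_nonneg _).trans (hM2 0)
  have hkl : Continuous fun x => klFun (ε + u x) := by fun_prop
  have hfi : Continuous fun x => ‖D x‖ ^ 2 / (ε + u x) :=
    Continuous.div (by fun_prop) (by fun_prop) fun x => (hpos x).ne'
  rw [integral_map hTm hkl.aestronglyMeasurable, integral_map hTm (by fun_prop),
    integral_map hTm hfi.aestronglyMeasurable]
  -- The inequality is pulled back to the standard Gaussian. By the chain rule the gradient of `y ↦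
  -- u (m + T y)` is `T* D`, so the Fisher information grows by at most the factor `l`.
  set A := ContinuousLinearMap.adjoint T
  have h := integral_klFun_stdGaussian_le (E := E) (f := fun y => ε + u (m + T y))
    (D := fun y => A (D (m + T y))) (ε := ε)
    (K := max (ε + M1) (‖A‖ * M2)) (fun y => ?_) (by fun_prop) hε
    (fun y => by linarith [hu0 (m + T y)])
    (fun y => ?_) (fun y => ?_)
  · refine h.trans ?_
    refine add_le_add le_rfl ?_
    rw [div_eq_mul_one_div l 2, mul_comm l, mul_assoc, ← integral_const_mul l]
    refine mul_le_mul_of_nonneg_left ?_ one_half_pos.le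
    have hbd : ∀ y, ‖‖D y‖ ^ 2 / (ε + u y)‖ ≤ M2 ^ 2 / ε := fun y => by
      rw [Real.norm_of_nonneg (div_nonneg (by positivity) (hpos y).le)]
      gcongr
      · exact hM2 y
      · linarith [hu0 y]
    refine integral_mono_of_nonneg (.of_forall fun y => div_nonneg (by positivity) (hpos _).le)
      ((integrable_of_continuous_bounded (f := fun y => ‖D (m + T y)‖ ^ 2 / (ε + u (m + T y)))
        (hfi.comp (by fun_prop : Continuous fun y => m + T y)) fun y => hbd _).const_mul l)
      (.of_forall fun y => ?_)
    simp only
    rw [← mul_div_assoc]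
    exact div_le_div_of_nonneg_right (hT _) (hpos _).le
  · have h1 : HasFDerivAt (fun y => m + T y) T y := T.hasFDerivAt.const_add m
    refine HasFDerivAt.congr_fderiv (((hD _).hasFDerivAt.comp y h1).const_add ε) ?_
    ext z
    simp [A, ContinuousLinearMap.adjoint_inner_left]
  · rw [abs_of_pos (hpos _)]
    exact le_max_of_le_left (by linarith [(le_abs_self _).trans (hM1 (m + T y))])
  · refine le_max_of_le_right ((A.le_opNorm _).trans ?_)
    gcongr
    exact hM2 _

/-- A normalized Gaussian density defines a probability measure that satisfies the logarithmic
Sobolev inequality. -/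
theorem satisfiesLSI_of_gaussian_density {κ : Type*} [Fintype κ]
    (L : EuclideanSpace ℝ κ ≃L[ℝ] EuclideanSpace ℝ κ) (m : EuclideanSpace ℝ κ)
    {ρ : EuclideanSpace ℝ κ → ℝ} {K l : ℝ} (hK : 0 < K) (hl : 0 < l)
    (hρ : ∀ y, ρ y = K * Real.exp (-(1 / 2) * ‖L (y - m)‖ ^ 2))
    (hL : ∀ w, ‖ContinuousLinearMap.adjoint
      (L.symm : EuclideanSpace ℝ κ →L[ℝ] EuclideanSpace ℝ κ) w‖ ^ 2 ≤ l * ‖w‖ ^ 2) :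
    IsProbabilityMeasure (volume.withDensity fun y => ENNReal.ofReal (ρ y / ∫ y', ρ y')) ∧
      SatisfiesLSI (volume.withDensity fun y => ENNReal.ofReal (ρ y / ∫ y', ρ y')) (1 / l) := by
  obtain ⟨c, hc, hmap⟩ := exists_map_stdGaussian_eq_withDensity L m
  have hprob : IsProbabilityMeasure
      ((stdGaussian (EuclideanSpace ℝ κ)).map fun y => m + L.symm y) :=
    Measure.isProbabilityMeasure_map (by fun_prop)
  have hprob' := hprob
  rw [hmap] at hprob'
  set p : EuclideanSpace ℝ κ → ℝ := fun z => c * Real.exp (-(1 / 2) * ‖L (z - m)‖ ^ 2) with hp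
  have hpc : Continuous p := by fun_prop
  have hp0 : ∀ x, 0 < p x := fun x => by positivity
  have hpC : ∀ x, |p x| ≤ c := fun x => by
    rw [abs_of_pos (hp0 x)]
    refine mul_le_of_le_one_right hc.le (Real.exp_le_one_iff.2 ?_)
    nlinarith [sq_nonneg ‖L (x - m)‖]
  have hint : ∫ y, p y = 1 := by
    have := integral_withDensity_ofReal hpc hp0 fun _ => 1
    simpa using this.symm
  -- The multiplicative constant of `ρ` cancels in the normalization, so only the quadratic form
  -- matters.
  have hdens : ∀ y, ρ y / ∫ y', ρ y' = p y := by
    have h1 : ∀ y, ρ y = (K / c) * p y := fun y => by rw [hρ, hp]; field_simp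
    have h2 : ∫ y', ρ y' = K / c := by
      simp_rw [h1]
      rw [integral_const_mul, hint, mul_one]
    intro y
    rw [h2, h1]
    field_simp
  simp_rw [hdens]
  refine ⟨hprob', SmoothLSI.satisfiesLSI hpc hp0 hpC hl ?_⟩
  rw [← hmap]
  exact smoothLSI_map_stdGaussian _ m hL

end AffineGaussian

/-! ### Positive definite matrices and comparison with their inverses -/

section PosDefMatrix

variable {ι : Type*} [Fintype ι] [DecidableEq ι]

open scoped MatrixOrder in
/-- A positive definite matrix is the Gram matrix of an invertible linear map. -/
theorem exists_continuousLinearEquiv_of_posDef {M : Matrix ι ι ℝ} (hM : M.PosDef) :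
    ∃ L : EuclideanSpace ℝ ι ≃L[ℝ] EuclideanSpace ℝ ι,
      (∀ y, ‖L y‖ ^ 2 = y.ofLp ⬝ᵥ M *ᵥ y.ofLp) ∧
      ∀ w, ‖ContinuousLinearMap.adjoint
        (L.symm : EuclideanSpace ℝ ι →L[ℝ] EuclideanSpace ℝ ι) w‖ ^ 2
          = w.ofLp ⬝ᵥ M⁻¹ *ᵥ w.ofLp := by
  -- The map is the positive square root of `M`; it is self-adjoint, so the adjoint of its inverse
  -- squares to `M⁻¹`.
  set N := CFC.sqrt M with hN
  have hNN : N * N = M := CFC.sqrt_mul_sqrt_self M hM.posSemidef.nonneg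
  have hNsa : star N = N := (CFC.sqrt_nonneg M).isSelfAdjoint
  have hNu : IsUnit N.det := by
    have h1 : IsUnit M.det := (Matrix.isUnit_iff_isUnit_det M).1 hM.isUnit
    rw [← hNN, det_mul] at h1
    exact isUnit_of_mul_isUnit_left h1
  have hMinv : N⁻¹ * N⁻¹ = M⁻¹ := by rw [← hNN, Matrix.mul_inv_rev]
  have hNisa : star N⁻¹ = N⁻¹ := by
    rw [star_eq_conjTranspose, conjTranspose_nonsing_inv, ← star_eq_conjTranspose, hNsa]
  let Φ := toEuclideanCLM (n := ι) (𝕜 := ℝ)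
  have hnorm : ∀ (S : Matrix ι ι ℝ) (y : EuclideanSpace ℝ ι), star S = S →
      ‖Φ S y‖ ^ 2 = y.ofLp ⬝ᵥ (S * S) *ᵥ y.ofLp := by
    intro S y hS
    rw [← inner_toEuclideanCLM, map_mul, ← real_inner_self_eq_norm_sq]
    change _ = inner ℝ y (Φ S (Φ S y))
    rw [← ContinuousLinearMap.adjoint_inner_left, ← ContinuousLinearMap.star_eq_adjoint,
      ← map_star, hS, real_inner_comm]
  refine ⟨ContinuousLinearEquiv.equivOfInverse (Φ N) (Φ N⁻¹) (fun y => ?_) (fun y => ?_),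
    fun y => ?_, fun w => ?_⟩
  · change (Φ N⁻¹ * Φ N) y = y
    rw [← map_mul, Matrix.nonsing_inv_mul _ hNu, map_one]; rfl
  · change (Φ N * Φ N⁻¹) y = y
    rw [← map_mul, Matrix.mul_nonsing_inv _ hNu, map_one]; rfl
  · rw [← hNN, ← hnorm N y hNsa]; rfl
  · rw [← hMinv, ← hnorm _ w hNisa]
    change ‖ContinuousLinearMap.adjoint (Φ N⁻¹) w‖ ^ 2 = _
    rw [← ContinuousLinearMap.star_eq_adjoint, ← map_star, hNisa]

theorem dotProduct_mulVec_comm_of_isHermitian {M : Matrix ι ι ℝ} (hM : M.IsHermitian)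
    (x y : ι → ℝ) : x ⬝ᵥ M *ᵥ y = (M *ᵥ x) ⬝ᵥ y := by
  have hT : Mᵀ = M := by simpa only [conjTranspose_eq_transpose_of_trivial] using hM.eq
  rw [dotProduct_mulVec, ← mulVec_transpose, hT]

theorem mulVec_inv_mulVec {M : Matrix ι ι ℝ} (hM : M.PosDef) (x : ι → ℝ) :
    M *ᵥ (M⁻¹ *ᵥ x) = x := by
  rw [mulVec_mulVec, Matrix.mul_nonsing_inv _ ((Matrix.isUnit_iff_isUnit_det M).1 hM.isUnit),
    one_mulVec]

/-- If `M ≤ l` then `1 ≤ l M⁻¹`. -/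
theorem dotProduct_self_le_of_mulVec_le {M : Matrix ι ι ℝ} (hM : M.PosDef) {l : ℝ} (hl : 0 < l)
    (h : ∀ x, x ⬝ᵥ M *ᵥ x ≤ l * (x ⬝ᵥ x)) (x : ι → ℝ) : x ⬝ᵥ x ≤ l * (x ⬝ᵥ M⁻¹ *ᵥ x) := by
  set u := M⁻¹ *ᵥ x
  have hu : M *ᵥ u = x := mulVec_inv_mulVec hM x
  -- Expanding with `M u = x` gives `2 l⁻¹ |x|² ≤ ⟨x, u⟩ + l⁻² ⟨x, M x⟩`, and the last term is at
  -- most `l⁻¹ |x|²`.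
  have h1 : 0 ≤ (u - l⁻¹ • x) ⬝ᵥ M *ᵥ (u - l⁻¹ • x) := by
    simpa using hM.posSemidef.dotProduct_mulVec_nonneg (u - l⁻¹ • x)
  rw [mulVec_sub, mulVec_smul, hu, sub_dotProduct, dotProduct_sub, dotProduct_sub,
    smul_dotProduct, smul_dotProduct, dotProduct_smul, dotProduct_smul,
    dotProduct_mulVec_comm_of_isHermitian hM.1 u x, hu, dotProduct_comm u x] at h1
  have h2 := h x
  have h3 : l⁻¹ * (l⁻¹ * (x ⬝ᵥ M *ᵥ x)) ≤ l⁻¹ * (x ⬝ᵥ x) := by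
    refine mul_le_mul_of_nonneg_left ?_ (by positivity)
    rw [inv_mul_le_iff₀ hl]; exact h2
  simp only [smul_eq_mul] at h1
  have h4 : l⁻¹ * (x ⬝ᵥ x) ≤ x ⬝ᵥ u := by linarith
  rwa [inv_mul_le_iff₀ hl] at h4

/-- If `1 ≤ l M` then `M⁻¹ ≤ l`. -/
theorem dotProduct_inv_mulVec_le {M : Matrix ι ι ℝ} (hM : M.PosDef) {l : ℝ}
    (h : ∀ x, x ⬝ᵥ x ≤ l * (x ⬝ᵥ M *ᵥ x)) (x : ι → ℝ) : x ⬝ᵥ M⁻¹ *ᵥ x ≤ l * (x ⬝ᵥ x) := by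
  set u := M⁻¹ *ᵥ x
  have hu : M *ᵥ u = x := mulVec_inv_mulVec hM x
  have h1 := h u
  rw [hu, dotProduct_comm u x] at h1
  -- Together with `|u|² ≤ l ⟨x, u⟩` this yields `l ⟨x, u⟩ ≤ l² |x|²`. Dividing requires `l > 0`;
  -- for `l ≤ 0` the hypothesis forces `x = 0`.
  have h2 : 0 ≤ (u - l • x) ⬝ᵥ (u - l • x) := by
    simpa using dotProduct_star_self_nonneg (u - l • x)
  rw [sub_dotProduct, dotProduct_sub, dotProduct_sub, smul_dotProduct, smul_dotProduct,
    dotProduct_smul, dotProduct_smul, dotProduct_comm u x] at h2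
  simp only [smul_eq_mul] at h2
  have h3 : 0 ≤ l * (l * (x ⬝ᵥ x) - x ⬝ᵥ u) := by linarith
  have h4 : 0 ≤ x ⬝ᵥ u := by
    have := hM.posSemidef.dotProduct_mulVec_nonneg u
    rw [hu, dotProduct_comm] at this
    simpa using this
  rcases le_or_gt l 0 with hl | hl
  · have h5 : 0 ≤ u ⬝ᵥ u := by simpa using dotProduct_star_self_nonneg u
    have h6 : u ⬝ᵥ u ≤ 0 := h1.trans (mul_nonpos_of_nonpos_of_nonneg hl h4)
    have h7 : u = 0 := dotProduct_self_eq_zero.1 (le_antisymm h6 h5)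
    have h8 : x = 0 := by rw [← hu, h7, mulVec_zero]
    simp [h8]
  · nlinarith [nonneg_of_mul_nonneg_right h3 hl]

end PosDefMatrix

/-! ### Decay of the semigroup of a Hurwitz matrix -/

section ExpDecay

open Filter Topology NormedSpace

/-- Powers of an element of spectral radius less than one converge to zero. -/
theorem tendsto_pow_of_spectralRadius_lt_one {R : Type*} [NormedRing R] [NormedAlgebra ℂ R]
    [CompleteSpace R] {a : R} (ha : spectralRadius ℂ a < 1) :
    Tendsto (fun n : ℕ => a ^ n) atTop (𝓝 0) := by
  obtain ⟨r, hr1, hr2⟩ := ENNReal.lt_iff_exists_nnreal_btwn.1 ha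
  have h := spectrum.pow_nnnorm_pow_one_div_tendsto_nhds_spectralRadius a
  have hr2' : r < 1 := by exact_mod_cast hr2
  have hlim : Tendsto (fun n : ℕ => (r : ℝ) ^ n) atTop (𝓝 0) :=
    tendsto_pow_atTop_nhds_zero_of_lt_one r.2 hr2'
  rw [tendsto_zero_iff_norm_tendsto_zero]
  refine squeeze_zero' (.of_forall fun n => norm_nonneg _) ?_ hlim
  filter_upwards [h.eventually_lt_const hr1, eventually_gt_atTop 0] with n hn hn0
  have h1 : ((‖a ^ n‖₊ : ℝ≥0∞) ^ (1 / n : ℝ)) ^ (n : ℝ) ≤ (r : ℝ≥0∞) ^ (n : ℝ) :=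
    ENNReal.rpow_le_rpow hn.le (by positivity)
  rw [← ENNReal.rpow_mul, one_div_mul_cancel (by positivity), ENNReal.rpow_one,
    ENNReal.rpow_natCast] at h1
  exact_mod_cast h1

/-- The exponential acts on eigenvectors. -/
theorem exp_apply_eq_of_apply_eq {V : Type*} [NormedAddCommGroup V] [NormedSpace ℂ V]
    [CompleteSpace V] {T : V →L[ℂ] V} {v : V} {z : ℂ} (h : T v = z • v) :
    exp T v = Complex.exp z • v := by
  have hpow : ∀ n : ℕ, (T ^ n) v = z ^ n • v := by
    intro n
    induction n with
    | zero => simp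
    | succ n ih =>
      rw [pow_succ']
      change T ((T ^ n) v) = _
      rw [ih, map_smul, h, smul_smul, pow_succ]
  have h1 := (exp_series_hasSum_exp' (𝕂 := ℂ) T).mapL (ContinuousLinearMap.apply ℂ V v)
  have h2 := (exp_series_hasSum_exp' (𝕂 := ℂ) z).smul_const v
  rw [Complex.exp_eq_exp_ℂ]
  refine h1.unique ?_
  convert h2 using 2 with n
  simp [hpow, smul_smul]

/-- The half of the spectral mapping theorem that is needed. An eigenspace of `exp T` is invariant
under `T`, so it contains an eigenvector of `T`, with eigenvalue `y` say. Hence every eigenvalue of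
`exp T` is some `e^y` with `Re y < 0`. -/
theorem spectralRadius_exp_lt_one {V : Type*} [NormedAddCommGroup V] [NormedSpace ℂ V]
    [FiniteDimensional ℂ V] {T : V →L[ℂ] V} (hT : ∀ z ∈ spectrum ℂ T, z.re < 0) :
    spectralRadius ℂ (exp T) < 1 := by
  have : CompleteSpace V := FiniteDimensional.complete ℂ V
  rcases (spectrum ℂ (exp T)).eq_empty_or_nonempty with hem | hne
  · rw [spectralRadius, hem]; simp
  refine spectrum.spectralRadius_lt_of_forall_lt_of_nonempty hne fun z hz => ?_
  let Ψ : (V →L[ℂ] V) ≃ₐ[ℂ] Module.End ℂ V := Module.End.toContinuousLinearMap V |>.symm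
  have hz' : z ∈ spectrum ℂ (Ψ (exp T)) := by rwa [AlgEquiv.spectrum_eq]
  rw [← Module.End.hasEigenvalue_iff_mem_spectrum] at hz'
  have hcomm : Commute (Ψ (exp T)) (Ψ T) := by
    have : Commute (exp T) T := (Commute.refl T).exp_left
    exact this.map Ψ
  set W := (Ψ (exp T)).eigenspace z with hW
  have hmaps : ∀ w ∈ W, Ψ T w ∈ W := fun w hw =>
    Module.End.mapsTo_genEigenspace_of_comm hcomm z 1 hw
  have : Nontrivial W := Submodule.nontrivial_iff_ne_bot.2 hz'
  obtain ⟨y, hy⟩ := Module.End.exists_eigenvalue ((Ψ T).restrict hmaps)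
  obtain ⟨w, hw⟩ := hy.exists_hasEigenvector
  have hw0 : (w : V) ≠ 0 := by simpa using hw.2
  have hTw : T w = y • (w : V) := congrArg Subtype.val hw.apply_eq_smul
  have hew : exp T (w : V) = z • (w : V) := Module.End.mem_eigenspace_iff.1 w.2
  have hyT : y ∈ spectrum ℂ T := by
    rw [← AlgEquiv.spectrum_eq Ψ, ← Module.End.hasEigenvalue_iff_mem_spectrum]
    exact Module.End.hasEigenvalue_of_hasEigenvector
      ⟨Module.End.mem_eigenspace_iff.2 hTw, hw0⟩
  have hzy : z = Complex.exp y := by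
    have h1 := exp_apply_eq_of_apply_eq hTw
    rw [hew] at h1
    exact smul_left_injective ℂ hw0 h1
  rw [hzy, ← NNReal.coe_lt_coe, coe_nnnorm, Complex.norm_exp]
  simpa using hT y hyT

variable {ι : Type*} [Fintype ι] [DecidableEq ι]

/-- The semigroup generated by a Hurwitz matrix converges to zero. -/
theorem IsHurwitz.tendsto_exp {B : Matrix ι ι ℝ} (hB : IsHurwitz B) :
    Tendsto (fun n : ℕ => exp ((n : ℝ) • toEuclideanCLM (n := ι) (𝕜 := ℝ) B)) atTop (𝓝 0) := by
  set a := toEuclideanCLM (n := ι) (𝕜 := ℝ) B with ha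
  -- Complexification of operators. As an injective linear map between finite-dimensional spaces it
  -- is a closed embedding, so convergence to zero can be checked after applying it.
  let f : (EuclideanSpace ℝ ι →L[ℝ] EuclideanSpace ℝ ι) →ₐ[ℝ]
      (EuclideanSpace ℂ ι →L[ℂ] EuclideanSpace ℂ ι) :=
    (((toEuclideanCLM (n := ι) (𝕜 := ℂ)).toAlgEquiv.restrictScalars ℝ).toAlgHom.comp
      (Complex.ofRealAm.mapMatrix)).comp
      (toEuclideanCLM (n := ι) (𝕜 := ℝ)).symm.toAlgEquiv.toAlgHom
  have hfinj : Function.Injective f := by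
    refine (toEuclideanCLM (n := ι) (𝕜 := ℂ)).injective.comp (Function.Injective.comp ?_
      (toEuclideanCLM (n := ι) (𝕜 := ℝ)).symm.injective)
    exact Matrix.map_injective Complex.ofReal_injective
  have hfa : f a = toEuclideanCLM (n := ι) (𝕜 := ℂ) (B.map fun r : ℝ => (r : ℂ)) := by
    change toEuclideanCLM (n := ι) (𝕜 := ℂ) (((toEuclideanCLM (n := ι) (𝕜 := ℝ)).symm a).map
      fun r : ℝ => (r : ℂ)) = _
    rw [ha, StarAlgEquiv.symm_apply_apply]
  have hemb : IsClosedEmbedding f := by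
    exact LinearMap.isClosedEmbedding_of_injective (f := f.toLinearMap) (LinearMap.ker_eq_bot.2 hfinj)
  have hfexp : f (exp a) = exp (f a) := by
    let _ : NormedAlgebra ℚ (EuclideanSpace ℝ ι →L[ℝ] EuclideanSpace ℝ ι) :=
      NormedAlgebra.restrictScalars ℚ ℝ _
    let _ : NormedAlgebra ℚ (EuclideanSpace ℂ ι →L[ℂ] EuclideanSpace ℂ ι) :=
      NormedAlgebra.restrictScalars ℚ ℂ _
    exact map_exp f hemb.continuous a
  have hrad : spectralRadius ℂ (exp (f a)) < 1 := by
    refine spectralRadius_exp_lt_one ?_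
    rw [hfa]
    intro z hz
    refine hB z ?_
    rwa [AlgEquiv.spectrum_eq] at hz
  have h1 := tendsto_pow_of_spectralRadius_lt_one hrad
  rw [hemb.isInducing.tendsto_nhds_iff, map_zero]
  refine h1.congr fun n => ?_
  simp only [Function.comp_apply]
  let _ : NormedAlgebra ℚ (EuclideanSpace ℝ ι →L[ℝ] EuclideanSpace ℝ ι) :=
    NormedAlgebra.restrictScalars ℚ ℝ _
  rw [Nat.cast_smul_eq_nsmul ℝ n a, NormedSpace.exp_nsmul, map_pow, hfexp]

end ExpDecay

/-! ### Solvability of the Lyapunov equation -/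

section Lyapunov

open Filter Topology NormedSpace

variable {E : Type*} [NormedAddCommGroup E] [InnerProductSpace ℝ E] [FiniteDimensional ℝ E]

theorem exp_mul_eq_mul_exp {R : Type*} [NormedRing R] [NormedAlgebra ℝ R] [CompleteSpace R]
    {a b q : R} (h : a * q = q * b) : exp a * q = q * exp b := by
  have hpow : ∀ n : ℕ, a ^ n * q = q * b ^ n := fun n =>
    (SemiconjBy.pow_right (a := q) (x := b) (y := a) h.symm n).symm
  have h1 := (exp_series_hasSum_exp' (𝕂 := ℝ) a).mul_right q
  have h2 := (exp_series_hasSum_exp' (𝕂 := ℝ) b).mul_left q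
  refine h1.unique ?_
  convert h2 using 2 with n
  rw [smul_mul_assoc, hpow, mul_smul_comm]

/-- The Lyapunov equation of a stable operator has a self-adjoint solution. -/
theorem exists_isSelfAdjoint_lyapunov {a C : E →L[ℝ] E}
    (ha : Tendsto (fun n : ℕ => exp ((n : ℝ) • a)) atTop (𝓝 0)) (hC : IsSelfAdjoint C) :
    ∃ Q : E →L[ℝ] E, IsSelfAdjoint Q ∧ a * Q + Q * star a = -C := by
  let Ly : (E →L[ℝ] E) →ₗ[ℝ] (E →L[ℝ] E) :=
    LinearMap.mulLeft ℝ a + LinearMap.mulRight ℝ (star a)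
  -- If `a q = -q a*`, then `e^{na} q e^{na*} = q` for all `n`, while the left side tends to `0`. In
  -- finite dimension injectivity gives surjectivity; it also makes the solution self-adjoint, since
  -- its adjoint solves the same equation.
  have hinj : Function.Injective Ly := by
    rw [injective_iff_map_eq_zero]
    intro q hq
    have hq' : a * q + q * star a = 0 := hq
    have h1 : ∀ n : ℕ, exp ((n : ℝ) • a) * q * star (exp ((n : ℝ) • a)) = q := by
      intro n
      let _ : NormedAlgebra ℚ (E →L[ℝ] E) := NormedAlgebra.restrictScalars ℚ ℝ _
      have h2 : ((n : ℝ) • a) * q = q * (-((n : ℝ) • star a)) := by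
        rw [smul_mul_assoc, eq_neg_of_add_eq_zero_left hq', mul_neg, mul_smul_comm, smul_neg]
      rw [exp_mul_eq_mul_exp h2, star_exp, star_smul, star_trivial (n : ℝ), mul_assoc]
      have h4 : exp (-((n : ℝ) • star a)) * exp ((n : ℝ) • star a) = 1 := by
        refine (NormedSpace.exp_add_of_commute (Commute.neg_left (Commute.refl _))).symm.trans ?_
        rw [neg_add_cancel, NormedSpace.exp_zero]
      rw [h4, mul_one]
    have h3 : Tendsto (fun n : ℕ => exp ((n : ℝ) • a) * q * star (exp ((n : ℝ) • a))) atTop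
        (𝓝 (0 * q * star 0)) := (ha.mul_const q).mul ha.star
    simp_rw [h1] at h3
    simpa using tendsto_nhds_unique tendsto_const_nhds h3
  obtain ⟨Q, hQ⟩ := (LinearMap.injective_iff_surjective.1 hinj) (-C)
  have hQ' : a * Q + Q * star a = -C := hQ
  refine ⟨Q, hinj ?_, hQ'⟩
  rw [hQ]
  change a * star Q + star Q * star a = -C
  have h := congrArg star hQ'
  rw [star_add, star_mul, star_mul, star_star, star_neg, hC.star_eq, add_comm] at h
  exact h

end Lyapunov

/-! ### Pathwise variation of constants -/

section VariationOfConstants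

open NormedSpace

variable {E : Type*} [NormedAddCommGroup E] [NormedSpace ℝ E] [CompleteSpace E]

theorem exp_neg_smul_mul_exp_smul (a : E →L[ℝ] E) (t : ℝ) :
    exp ((-t) • a) * exp (t • a) = 1 := by
  let _ : NormedAlgebra ℚ (E →L[ℝ] E) := NormedAlgebra.restrictScalars ℚ ℝ _
  refine (NormedSpace.exp_add_of_commute
    (((Commute.refl a).smul_left _).smul_right _)).symm.trans ?_
  rw [← add_smul, neg_add_cancel, zero_smul, NormedSpace.exp_zero]

theorem exp_add_smul_eq_mul (a : E →L[ℝ] E) (s t : ℝ) :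
    exp ((s + t) • a) = exp (s • a) * exp (t • a) := by
  let _ : NormedAlgebra ℚ (E →L[ℝ] E) := NormedAlgebra.restrictScalars ℚ ℝ _
  rw [add_smul]
  exact NormedSpace.exp_add_of_commute (((Commute.refl a).smul_left _).smul_right _)

theorem continuous_exp_smul (a : E →L[ℝ] E) : Continuous fun t : ℝ => exp (t • a) :=
  continuous_iff_continuousAt.2 fun t => (hasDerivAt_exp_smul_const (𝕂 := ℝ) a t).continuousAt

/-- Variation of constants for a linear integral equation with additive forcing `w`. -/
theorem eq_exp_add_of_integral_eq (a : E →L[ℝ] E) {z w : ℝ → E} {z₀ : E} (hz : Continuous z)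
    (hw : Continuous w) (h : ∀ t, 0 ≤ t → z t = z₀ + (∫ s in (0 : ℝ)..t, a (z s)) + w t)
    {t : ℝ} (ht : 0 ≤ t) :
    z t = exp (t • a) z₀ + w t + exp (t • a) (∫ s in (0 : ℝ)..t, exp ((-s) • a) (a (w s))) := by
  -- The forcing `w` is only continuous, but `u = z - w` is differentiable with `u' = a u + a w`,
  -- and so `e^{-sa} u` has derivative `e^{-sa} a w`.
  set u : ℝ → E := fun s => z₀ + ∫ r in (0 : ℝ)..s, a (z r) with hu
  have haz : Continuous fun s => a (z s) := a.continuous.comp hz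
  have hu' : ∀ s, HasDerivAt u (a (z s)) s := fun s =>
    (intervalIntegral.integral_hasDerivAt_right (haz.intervalIntegrable _ _)
      (haz.stronglyMeasurableAtFilter _ _) haz.continuousAt).const_add z₀
  have hS : ∀ s : ℝ, HasDerivAt (fun s : ℝ => exp ((-s) • a)) (-(exp ((-s) • a) * a)) s := by
    intro s
    have h1 := (hasDerivAt_exp_smul_const (𝕂 := ℝ) a (-s)).scomp s (hasDerivAt_neg s)
    simpa [Function.comp_def] using h1
  have hv : ∀ s, HasDerivAt (fun s => exp ((-s) • a) (u s))
      (-(exp ((-s) • a) * a) (u s) + exp ((-s) • a) (a (z s))) s := fun s =>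
    (hS s).clm_apply (hu' s)
  have hint : ∫ s in (0 : ℝ)..t, exp ((-s) • a) (a (w s)) = exp ((-t) • a) (u t) - z₀ := by
    have hcont : Continuous fun s : ℝ => exp ((-s) • a) (a (w s)) :=
      ((continuous_exp_smul a).comp continuous_neg).clm_apply (a.continuous.comp hw)
    rw [intervalIntegral.integral_eq_sub_of_hasDerivAt (f := fun s => exp ((-s) • a) (u s))
      (fun s hs => ?_) (hcont.intervalIntegrable _ _)]
    · simp [hu]
    · convert hv s using 1
      rw [Set.uIcc_of_le ht] at hs
      have : z s = u s + w s := h s hs.1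
      rw [this]
      simp
  rw [hint, map_sub]
  have h2 : exp (t • a) (exp ((-t) • a) (u t)) = u t := by
    have := exp_neg_smul_mul_exp_smul a (-t)
    rw [neg_neg] at this
    exact congrArg (fun f : E →L[ℝ] E => f (u t)) this
  rw [h2]
  have h3 : z t = u t + w t := h t ht
  rw [h3]
  abel

/-- The constant depends on `a` alone, so the estimate is uniform over the paths of the noise. For
Brownian `w` the error has mean of order `t^{3/2}`, which is negligible against `t`. -/
theorem exists_norm_sub_exp_sub_le (a : E →L[ℝ] E) :
    ∃ C : ℝ, 0 ≤ C ∧ ∀ (z w : ℝ → E) (z₀ : E), Continuous z → Continuous w →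
      (∀ t, 0 ≤ t → z t = z₀ + (∫ s in (0 : ℝ)..t, a (z s)) + w t) →
      ∀ t ∈ Set.Icc (0 : ℝ) 1, ‖z t - (exp (t • a) z₀ + w t)‖ ≤ C * ∫ s in (0 : ℝ)..t, ‖w s‖ := by
  obtain ⟨c, hc⟩ := (isCompact_Icc (a := (-1 : ℝ)) (b := 1)).exists_bound_of_continuousOn
    (continuous_exp_smul a).continuousOn
  have hc0 : 0 ≤ c := (norm_nonneg _).trans (hc 0 (by norm_num))
  refine ⟨c * (c * ‖a‖), by positivity, fun z w z₀ hz hw h t ht => ?_⟩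
  rw [eq_exp_add_of_integral_eq a hz hw h ht.1, add_sub_cancel_left]
  refine (ContinuousLinearMap.le_opNorm _ _).trans ?_
  rw [mul_assoc]
  gcongr
  · exact hc t ⟨by linarith [ht.1], ht.2⟩
  · rw [← intervalIntegral.integral_const_mul]
    refine intervalIntegral.norm_integral_le_of_norm_le ht.1 (.of_forall fun s hs => ?_)
      ((continuous_const.mul hw.norm).intervalIntegrable _ _)
    refine (ContinuousLinearMap.le_opNorm _ _).trans ?_
    rw [mul_assoc]
    gcongr
    · exact hc (-s) ⟨by linarith [hs.2, ht.2], by linarith [hs.1]⟩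
    · exact ContinuousLinearMap.le_opNorm _ _

end VariationOfConstants

/-! ### Moment bounds and characteristic function of Brownian motion -/

section BrownianMotion

variable {Ω κ : Type*} [MeasurableSpace Ω] [Fintype κ] {P : Measure Ω}

/-- `(E|X|)² ≤ E X² = t`, because the variance of `|X|` is nonnegative. -/
theorem lintegral_enorm_gaussianReal_le (t : ℝ≥0) :
    ∫⁻ x, ‖x‖ₑ ∂(gaussianReal 0 t) ≤ ENNReal.ofReal (Real.sqrt t) := by
  have hint : Integrable (fun x : ℝ => ‖x‖) (gaussianReal 0 t) :=
    ((memLp_id_gaussianReal (μ := 0) (v := t) 1).integrable le_rfl).norm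
  have h2 : MemLp (fun x : ℝ => ‖x‖) 2 (gaussianReal 0 t) :=
    (memLp_id_gaussianReal (μ := 0) (v := t) 2).norm
  have hv := variance_nonneg (fun x : ℝ => ‖x‖) (gaussianReal 0 t)
  rw [variance_eq_sub h2] at hv
  have h3 : ∫ x : ℝ, x ^ 2 ∂(gaussianReal 0 t) = t := by
    have h4 := variance_id_gaussianReal (μ := 0) (v := t)
    rw [variance_eq_sub (memLp_id_gaussianReal 2)] at h4
    simpa using h4
  have h5 : ∫ x : ℝ, ‖x‖ ∂(gaussianReal 0 t) ≤ Real.sqrt t := by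
    refine Real.le_sqrt_of_sq_le ?_
    rw [← h3]
    simpa using hv
  have h6 := ofReal_integral_eq_lintegral_ofReal hint (.of_forall fun x => norm_nonneg x)
  simp only [ofReal_norm] at h6
  rw [← h6]
  exact ENNReal.ofReal_le_ofReal h5

theorem IsBrownianMotion.lintegral_enorm_le {W : ℝ≥0 → Ω → EuclideanSpace ℝ κ}
    (hW : IsBrownianMotion W P) (t : ℝ≥0) :
    ∫⁻ ω, ‖W t ω‖ₑ ∂P ≤ Fintype.card κ * ENNReal.ofReal (Real.sqrt t) := by
  have h1 : ∀ ω, ‖W t ω‖ₑ ≤ ∑ i, ‖W t ω i‖ₑ := by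
    intro ω
    classical
    have h2 : W t ω = ∑ i, EuclideanSpace.single i (W t ω i) := by
      ext j
      simp [Pi.single_apply]
    calc ‖W t ω‖ₑ = ‖∑ i, EuclideanSpace.single i (W t ω i)‖ₑ := congrArg _ h2
      _ ≤ ∑ i, ‖EuclideanSpace.single i (W t ω i)‖ₑ := enorm_sum_le _ _
      _ = ∑ i, ‖W t ω i‖ₑ := by
        refine Finset.sum_congr rfl fun i _ => ?_
        rw [← ofReal_norm, ← ofReal_norm, PiLp.norm_single]
  have hm : ∀ i, Measurable fun ω => W t ω i := fun i =>
    (measurable_pi_apply i).comp ((WithLp.measurable_ofLp 2 _).comp (hW.measurable t))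
  calc ∫⁻ ω, ‖W t ω‖ₑ ∂P ≤ ∫⁻ ω, ∑ i, ‖W t ω i‖ₑ ∂P := lintegral_mono h1
    _ = ∑ i, ∫⁻ ω, ‖W t ω i‖ₑ ∂P := lintegral_finsetSum _ fun i _ => (hm i).enorm
    _ ≤ ∑ _i : κ, ENNReal.ofReal (Real.sqrt t) := by
        refine Finset.sum_le_sum fun i _ => ?_
        have h2 := ((hW.isBrownian i).hasLaw_eval t).map_eq
        have h3 := lintegral_enorm_gaussianReal_le t
        rw [← h2, lintegral_map measurable_enorm (hm i)] at h3
        exact h3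
    _ = _ := by simp

theorem IsBrownianMotion.ae_continuous {W : ℝ≥0 → Ω → EuclideanSpace ℝ κ}
    (hW : IsBrownianMotion W P) : ∀ᵐ ω ∂P, Continuous fun t => W t ω := by
  have := ae_all_iff.2 fun i => (hW.isBrownian i).cont
  filter_upwards [this] with ω hω
  exact (PiLp.continuous_toLp 2 _).comp (continuous_pi hω)

theorem IsBrownianMotion.lintegral_lintegral_enorm_le {W : ℝ≥0 → Ω → EuclideanSpace ℝ κ}
    [SFinite P] (hW : IsBrownianMotion W P) (δ : ℝ) :
    ∫⁻ ω, (∫⁻ s in Set.Ioc 0 δ, ‖W s.toNNReal ω‖ₑ) ∂P ≤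
      ENNReal.ofReal (Fintype.card κ * (Real.sqrt δ * δ)) := by
  -- Paths are continuous only almost surely. Setting the process to zero on a measurable null set
  -- makes every path continuous, hence the process jointly measurable, as Tonelli requires.
  obtain ⟨N, hN, hNm, hN0⟩ := exists_measurable_superset_of_null (ae_iff.1 hW.ae_continuous)
  let V : ℝ → Ω → EuclideanSpace ℝ κ := fun s => Nᶜ.indicator (W s.toNNReal)
  have hVm : ∀ s, Measurable (V s) := fun s => (hW.measurable _).indicator hNm.compl
  have hVc : ∀ ω, Continuous fun s => V s ω := by
    intro ω
    by_cases hω : ω ∈ N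
    · simp only [V, Set.indicator_of_notMem (show ω ∉ Nᶜ from fun h => h hω)]
      exact continuous_const
    · simp only [V, Set.indicator_of_mem (show ω ∈ Nᶜ from hω)]
      have : Continuous fun t => W t ω := by
        by_contra hcon
        exact hω (hN hcon)
      exact this.comp continuous_real_toNNReal
  have hae : ∀ᵐ ω ∂P, ∀ s, V s ω = W s.toNNReal ω := by
    filter_upwards [measure_eq_zero_iff_ae_notMem.1 hN0] with ω hω s
    exact Set.indicator_of_mem (show ω ∈ Nᶜ from hω) _
  have hVu : Measurable (Function.uncurry V) :=
    measurable_uncurry_of_continuous_of_measurable hVc hVm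
  calc ∫⁻ ω, (∫⁻ s in Set.Ioc 0 δ, ‖W s.toNNReal ω‖ₑ) ∂P
      = ∫⁻ ω, (∫⁻ s in Set.Ioc 0 δ, ‖V s ω‖ₑ) ∂P := by
        refine lintegral_congr_ae ?_
        filter_upwards [hae] with ω hω
        simp only [hω]
    _ = ∫⁻ s in Set.Ioc 0 δ, ∫⁻ ω, ‖V s ω‖ₑ ∂P :=
        lintegral_lintegral_swap (hVu.comp measurable_swap).enorm.aemeasurable
    _ ≤ ∫⁻ s in Set.Ioc 0 δ, Fintype.card κ * ENNReal.ofReal (Real.sqrt δ) := by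
        refine setLIntegral_mono' measurableSet_Ioc fun s hs => ?_
        have h1 : ∫⁻ ω, ‖V s ω‖ₑ ∂P = ∫⁻ ω, ‖W s.toNNReal ω‖ₑ ∂P := by
          refine lintegral_congr_ae ?_
          filter_upwards [hae] with ω hω
          rw [hω]
        rw [h1]
        refine (hW.lintegral_enorm_le _).trans ?_
        gcongr
        rw [Real.coe_toNNReal _ hs.1.le]
        exact hs.2
    _ = _ := by
        rw [setLIntegral_const, Real.volume_Ioc, sub_zero, ENNReal.ofReal_mul (by positivity),
          ENNReal.ofReal_mul (by positivity), ENNReal.ofReal_natCast, mul_assoc]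

/-- The characteristic function of Brownian motion at time `t`. -/
theorem IsBrownianMotion.charFun_map {W : ℝ≥0 → Ω → EuclideanSpace ℝ κ}
    [IsProbabilityMeasure P] (hW : IsBrownianMotion W P) (t : ℝ≥0) (η : EuclideanSpace ℝ κ) :
    charFun (P.map (W t)) η = Complex.exp (-(t * ‖η‖ ^ 2 / 2 : ℝ)) := by
  have hm : ∀ i, Measurable fun ω => W t ω i := fun i =>
    (measurable_pi_apply i).comp ((WithLp.measurable_ofLp 2 _).comp (hW.measurable t))
  have hind : iIndepFun (fun i ω => W t ω i) P :=
    hW.indep.comp (fun _ x => x t) fun _ => measurable_pi_apply t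
  have h1 := (iIndepFun_iff_charFun_pi fun i => (hm i).aemeasurable).1 hind η
  have h2 : (fun ω => WithLp.toLp 2 (fun i => W t ω i)) = W t := rfl
  rw [h2] at h1
  rw [h1]
  have h3 : ∀ i, charFun (P.map fun ω => W t ω i) (η i)
      = Complex.exp (-(t * (η i) ^ 2 / 2 : ℝ)) := by
    intro i
    rw [((hW.isBrownian i).hasLaw_eval t).map_eq, charFun_gaussianReal]
    congr 1
    push_cast
    ring
  simp_rw [h3]
  rw [← Complex.exp_sum, EuclideanSpace.real_norm_sq_eq]
  congr 1
  push_cast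
  rw [Finset.sum_neg_distrib, Finset.mul_sum, Finset.sum_div]

end BrownianMotion

/-- The function `x ↦ e^{i⟨x, ξ⟩}` is Lipschitz with constant `‖ξ‖`. -/
theorem enorm_charFun_map_sub_le {Ω E : Type*} [MeasurableSpace Ω] {P : Measure Ω}
    [IsProbabilityMeasure P] [NormedAddCommGroup E] [InnerProductSpace ℝ E] [MeasurableSpace E]
    [BorelSpace E] [SecondCountableTopology E] {X Y : Ω → E} (hX : Measurable X)
    (hY : Measurable Y) (ξ : E) :
    ‖charFun (P.map X) ξ - charFun (P.map Y) ξ‖ₑ ≤ ‖ξ‖ₑ * ∫⁻ ω, ‖X ω - Y ω‖ₑ ∂P := by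
  have hexp : ∀ V : Ω → E, Measurable V →
      Integrable (fun ω => Complex.exp (inner ℝ (V ω) ξ * Complex.I)) P := by
    intro V hV
    refine Integrable.of_bound (C := 1) ?_ (.of_forall fun ω => ?_)
    · have : Measurable fun ω => (inner ℝ (V ω) ξ : ℝ) := hV.inner measurable_const
      exact (by fun_prop : Measurable _).aestronglyMeasurable
    · rw [Complex.norm_exp_ofReal_mul_I]
  have hmap : ∀ V : Ω → E, Measurable V →
      charFun (P.map V) ξ = ∫ ω, Complex.exp (inner ℝ (V ω) ξ * Complex.I) ∂P := by
    intro V hV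
    rw [charFun_apply, integral_map hV.aemeasurable]
    exact (by fun_prop : Continuous fun x : E =>
      Complex.exp ((inner ℝ x ξ : ℝ) * Complex.I)).aestronglyMeasurable
  rw [hmap X hX, hmap Y hY, ← integral_sub (hexp X hX) (hexp Y hY)]
  refine (enorm_integral_le_lintegral_enorm _).trans ?_
  rw [← lintegral_const_mul _ (show Measurable fun ω => ‖X ω - Y ω‖ₑ from (hX.sub hY).enorm)]
  refine lintegral_mono fun ω => ?_
  have h1 : Complex.exp ((inner ℝ (X ω) ξ : ℝ) * Complex.I)
      - Complex.exp ((inner ℝ (Y ω) ξ : ℝ) * Complex.I)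
      = Complex.exp ((inner ℝ (Y ω) ξ : ℝ) * Complex.I) *
        (Complex.exp (Complex.I * (inner ℝ (X ω - Y ω) ξ : ℝ)) - 1) := by
    rw [mul_sub, ← Complex.exp_add, mul_one, inner_sub_left]
    congr 2
    push_cast
    ring
  rw [h1, enorm_mul, ← ofReal_norm (Complex.exp _), Complex.norm_exp_ofReal_mul_I,
    ENNReal.ofReal_one, one_mul]
  refine (Real.enorm_exp_I_mul_ofReal_sub_one_le).trans ?_
  rw [← ofReal_norm, ← ofReal_norm, ← ofReal_norm, ← ENNReal.ofReal_mul (norm_nonneg _), mul_comm]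
  exact ENNReal.ofReal_le_ofReal (norm_inner_le_norm _ _)

/-! ### The characteristic function of a stationary solution -/

section StationaryCharFun

open Filter Topology NormedSpace

variable {Ω ι κ : Type*} [MeasurableSpace Ω] [Fintype ι] [DecidableEq ι] [Fintype κ]
  [DecidableEq κ] {B : Matrix ι ι ℝ} {A : Matrix ι κ ℝ} {P : Measure Ω} [IsProbabilityMeasure P]
  {W : ℝ≥0 → Ω → EuclideanSpace ℝ κ} {Z : ℝ≥0 → Ω → EuclideanSpace ℝ ι}

theorem charFun_map_clm {F F' : Type*} [NormedAddCommGroup F] [InnerProductSpace ℝ F]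
    [FiniteDimensional ℝ F] [MeasurableSpace F] [BorelSpace F] [NormedAddCommGroup F']
    [InnerProductSpace ℝ F'] [FiniteDimensional ℝ F'] [MeasurableSpace F'] [BorelSpace F']
    (L : F →L[ℝ] F') {X : Ω → F} (hX : Measurable X) (η : F') :
    charFun (P.map fun ω => L (X ω)) η = charFun (P.map X) (ContinuousLinearMap.adjoint L η) := by
  have h1 : P.map (fun ω => L (X ω)) = (P.map X).map L :=
    (Measure.map_map L.continuous.measurable hX).symm
  rw [h1, charFun_apply, charFun_apply, integral_map L.continuous.aemeasurable]
  · simp_rw [ContinuousLinearMap.adjoint_inner_right]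
  · exact (by fun_prop : Continuous fun x : F' =>
      Complex.exp ((inner ℝ x η : ℝ) * Complex.I)).aestronglyMeasurable

theorem charFun_map_add_eq_of_isLinearSDESolution (hW : IsBrownianMotion W P)
    (hZ : IsLinearSDESolution B A W Z P) (T : EuclideanSpace ℝ ι →L[ℝ] EuclideanSpace ℝ ι)
    (G : EuclideanSpace ℝ κ →L[ℝ] EuclideanSpace ℝ ι) (t : ℝ≥0) (ξ : EuclideanSpace ℝ ι) :
    charFun (P.map fun ω => T (Z 0 ω) + G (W t ω)) ξ =
      charFun (P.map (Z 0)) (ContinuousLinearMap.adjoint T ξ) *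
        Complex.exp (-(t * ‖ContinuousLinearMap.adjoint G ξ‖ ^ 2 / 2 : ℝ)) := by
  have hZm := hZ.measurable 0
  have hWm := hW.measurable t
  have hind : IndepFun (fun ω => T (Z 0 ω)) (fun ω => G (W t ω)) P :=
    hZ.indep_initial.comp (φ := fun z => T z)
      (ψ := fun w : ℝ≥0 → EuclideanSpace ℝ κ => G (w t))
      T.continuous.measurable (G.continuous.measurable.comp (measurable_pi_apply t))
  have hTm : AEMeasurable (fun ω => T (Z 0 ω)) P := (T.continuous.measurable.comp hZm).aemeasurable
  have hGm : AEMeasurable (fun ω => G (W t ω)) P := (G.continuous.measurable.comp hWm).aemeasurable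
  rw [hind.charFun_map_fun_add_eq_mul hTm hGm, Pi.mul_apply, charFun_map_clm T hZm,
    charFun_map_clm G hWm, hW.charFun_map]

/-- Short-time expansion of the characteristic function of a stationary solution. -/
theorem exists_enorm_charFun_sub_le (hW : IsBrownianMotion W P)
    (hZ : IsLinearSDESolution B A W Z P) {μ : Measure (EuclideanSpace ℝ ι)}
    (hμ : ∀ t : ℝ≥0, P.map (Z t) = μ) :
    ∃ C : ℝ, 0 ≤ C ∧ ∀ δ ∈ Set.Icc (0 : ℝ) 1, ∀ ξ : EuclideanSpace ℝ ι,
      ‖charFun μ ξ - charFun μ (ContinuousLinearMap.adjoint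
          (exp (δ • toEuclideanCLM (n := ι) (𝕜 := ℝ) B)) ξ) *
        Complex.exp (-(δ * ‖ContinuousLinearMap.adjoint
          (toEuclideanLin A).toContinuousLinearMap ξ‖ ^ 2 / 2 : ℝ))‖
        ≤ C * ‖ξ‖ * (Real.sqrt δ * δ) := by
  set a := toEuclideanCLM (n := ι) (𝕜 := ℝ) B with ha
  set G := (toEuclideanLin A).toContinuousLinearMap with hG
  obtain ⟨C, hC0, hC⟩ := exists_norm_sub_exp_sub_le a
  refine ⟨C * ‖G‖ * Fintype.card κ, by positivity, fun δ hδ ξ => ?_⟩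
  set t : ℝ≥0 := ⟨δ, hδ.1⟩ with ht
  have htd : (t : ℝ) = δ := rfl
  have hX := hZ.measurable t
  have hY : Measurable fun ω => exp (δ • a) (Z 0 ω) + G (W t ω) :=
    ((exp (δ • a)).continuous.measurable.comp (hZ.measurable 0)).add
      (G.continuous.measurable.comp (hW.measurable t))
  have h1 := enorm_charFun_map_sub_le (P := P) hX hY ξ
  rw [charFun_map_add_eq_of_isLinearSDESolution hW hZ, hμ, hμ, htd] at h1
  -- Stationarity has just replaced the laws of `Z t` and `Z 0` by `μ`. What remains is the mean
  -- distance between `Z t` and its approximation, bounded path by path.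
  have h2 : ∀ᵐ ω ∂P, ‖Z t ω - (exp (δ • a) (Z 0 ω) + G (W t ω))‖ₑ ≤
      ENNReal.ofReal (C * ‖G‖) * ∫⁻ s in Set.Ioc 0 δ, ‖W s.toNNReal ω‖ₑ := by
    filter_upwards [hZ.continuous_paths, hZ.equation, hW.ae_continuous] with ω hz he hw
    have hw' : Continuous fun s : ℝ => W s.toNNReal ω := hw.comp continuous_real_toNNReal
    have h3 := hC (fun s => Z s.toNNReal ω) (fun s => G (W s.toNNReal ω)) (Z 0 ω)
      (hz.comp continuous_real_toNNReal) (G.continuous.comp hw') (fun s hs => by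
        have h4 := he s.toNNReal
        rw [Real.coe_toNNReal _ hs] at h4
        exact h4) δ hδ
    have h5 : δ.toNNReal = t := Real.toNNReal_of_nonneg hδ.1
    simp only [h5] at h3
    have h6 : ∫ s in (0 : ℝ)..δ, ‖G (W s.toNNReal ω)‖ ≤
        ‖G‖ * ∫ s in (0 : ℝ)..δ, ‖W s.toNNReal ω‖ := by
      rw [← intervalIntegral.integral_const_mul]
      exact intervalIntegral.integral_mono_on hδ.1
        ((G.continuous.comp hw').norm.intervalIntegrable _ _)
        ((continuous_const.mul hw'.norm).intervalIntegrable _ _)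
        fun s _ => G.le_opNorm _
    have h7 : ENNReal.ofReal (∫ s in (0 : ℝ)..δ, ‖W s.toNNReal ω‖) =
        ∫⁻ s in Set.Ioc 0 δ, ‖W s.toNNReal ω‖ₑ := by
      rw [intervalIntegral.integral_of_le hδ.1, ofReal_integral_eq_lintegral_ofReal
        ((hw'.norm.intervalIntegrable (μ := volume) 0 δ).1) (.of_forall fun _ => norm_nonneg _)]
      simp only [ofReal_norm]
    rw [← h7, ← ofReal_norm, ← ENNReal.ofReal_mul (by positivity)]
    refine ENNReal.ofReal_le_ofReal (h3.trans ?_)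
    rw [mul_assoc]
    gcongr
  have h3 : ∫⁻ ω, ‖Z t ω - (exp (δ • a) (Z 0 ω) + G (W t ω))‖ₑ ∂P ≤
      ENNReal.ofReal (C * ‖G‖) * ENNReal.ofReal (Fintype.card κ * (Real.sqrt δ * δ)) := by
    refine (lintegral_mono_ae h2).trans ?_
    rw [lintegral_const_mul' _ _ ENNReal.ofReal_ne_top]
    gcongr
    exact hW.lintegral_lintegral_enorm_le δ
  have h4 := h1.trans (mul_le_mul_right h3 _)
  rw [← ENNReal.ofReal_mul (by positivity), ← ofReal_norm, ← ofReal_norm,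
    ← ENNReal.ofReal_mul (norm_nonneg _), ENNReal.ofReal_le_ofReal_iff
      (by have := hδ.1; positivity)] at h4
  refine h4.trans (le_of_eq ?_)
  ring

/-- A function with `‖f s - f (s + δ) * exp (-δ * c)‖ = O (δ * √δ)` has right derivative `c * f s`
at `s`. -/
theorem hasDerivWithinAt_of_norm_sub_mul_exp_le {f : ℝ → ℂ} {s c D : ℝ}
    (h : ∀ δ ∈ Set.Icc (0 : ℝ) 1,
      ‖f s - f (s + δ) * Complex.exp (-(δ * c : ℝ))‖ ≤ D * (Real.sqrt δ * δ)) :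
    HasDerivWithinAt f (c * f s) (Set.Ici s) s := by
  -- The assumption says that this product deviates from `f s` by `o(t - s)`; multiplying by
  -- `e^{(t-s)c}` then gives the derivative of `f`.
  have hk : HasDerivWithinAt (fun t : ℝ => f t * Complex.exp (-((t - s) * c : ℝ))) 0
      (Set.Ici s) s := by
    rw [hasDerivWithinAt_iff_isLittleO]
    have hO : (fun t : ℝ => f t * Complex.exp (-((t - s) * c : ℝ)) - f s)
        =O[𝓝[Set.Ici s] s] fun t => Real.sqrt (t - s) * (t - s) := by
      refine Asymptotics.IsBigO.of_bound D ?_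
      have hnear : ∀ᶠ t in 𝓝[Set.Ici s] s, t ∈ Set.Icc s (s + 1) :=
        Icc_mem_nhdsGE (by linarith)
      filter_upwards [hnear] with t ht
      have h0 : 0 ≤ t - s := by linarith [ht.1]
      have := h (t - s) ⟨h0, by linarith [ht.2]⟩
      rw [add_sub_cancel, norm_sub_rev] at this
      rwa [Real.norm_of_nonneg (by positivity)]
    have ho : (fun t : ℝ => Real.sqrt (t - s) * (t - s)) =o[𝓝[Set.Ici s] s] fun t => t - s := by
      have h1 : (fun t : ℝ => Real.sqrt (t - s)) =o[𝓝[Set.Ici s] s] fun _ => (1 : ℝ) := by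
        rw [Asymptotics.isLittleO_one_iff]
        have : Continuous fun t : ℝ => Real.sqrt (t - s) := by fun_prop
        have h2 := (this.tendsto s).mono_left (nhdsWithin_le_nhds (s := Set.Ici s))
        simpa using h2
      simpa using h1.mul_isBigO (Asymptotics.isBigO_refl (fun t : ℝ => t - s) _)
    simpa using hO.trans_isLittleO ho
  have hE : HasDerivAt (fun t : ℝ => Complex.exp (((t - s) * c : ℝ))) c s := by
    have h1 : HasDerivAt (fun t : ℝ => (((t - s) * c : ℝ) : ℂ)) c s := by
      have := (((hasDerivAt_id s).sub_const s).mul_const c).ofReal_comp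
      simpa using this
    simpa using h1.cexp
  have h2 := hk.mul hE.hasDerivWithinAt
  simp only [zero_mul, zero_add, sub_self, Complex.ofReal_zero, neg_zero, Complex.exp_zero,
    mul_one] at h2
  rw [mul_comm]
  refine h2.congr_of_eventuallyEq (.of_forall fun t => ?_) ?_
  · simp only [Pi.mul_apply]
    rw [mul_assoc, ← Complex.exp_add, neg_add_cancel, Complex.exp_zero, mul_one]
  · simp

/-- A short-time expansion along a stable semigroup determines a Gaussian characteristic function,
with covariance operator given by the Lyapunov equation. -/
theorem charFun_eq_exp_of_norm_charFun_sub_le {E F : Type*} [NormedAddCommGroup E]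
    [InnerProductSpace ℝ E] [FiniteDimensional ℝ E] [MeasurableSpace E] [BorelSpace E]
    [NormedAddCommGroup F] [InnerProductSpace ℝ F] [FiniteDimensional ℝ F] {μ : Measure E}
    [IsProbabilityMeasure μ] {a Q : E →L[ℝ] E} {G : F →L[ℝ] E}
    (hstable : Tendsto (fun n : ℕ => exp ((n : ℝ) • a)) atTop (𝓝 0))
    (hQ : a * Q + Q * star a = -(G ∘L ContinuousLinearMap.adjoint G)) {C : ℝ}
    (hC : ∀ δ ∈ Set.Icc (0 : ℝ) 1, ∀ ξ : E,
      ‖charFun μ ξ - charFun μ (ContinuousLinearMap.adjoint (exp (δ • a)) ξ) *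
        Complex.exp (-(δ * ‖ContinuousLinearMap.adjoint G ξ‖ ^ 2 / 2 : ℝ))‖
        ≤ C * ‖ξ‖ * (Real.sqrt δ * δ)) (ξ : E) :
    charFun μ ξ = Complex.exp (-(inner ℝ ξ (Q ξ) / 2 : ℝ)) := by
  set η : ℝ → E := fun s => exp (s • star a) ξ with hη
  have hadj : ∀ (s : ℝ), ContinuousLinearMap.adjoint (exp (s • a)) = exp (s • star a) := by
    intro s
    let _ : NormedAlgebra ℚ (E →L[ℝ] E) :=
      NormedAlgebra.restrictScalars ℚ ℝ _
    have h1 := star_exp (s • a)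
    rw [star_smul, star_trivial s] at h1
    exact h1
  have hη' : ∀ s, HasDerivAt η (star a (η s)) s := fun s =>
    (hasDerivAt_exp_smul_const' (𝕂 := ℝ) (star a) s).clm_apply (hasDerivAt_const s ξ) |>.congr_deriv
      (by simp [hη])
  have hηc : Continuous η := continuous_iff_continuousAt.2 fun s => (hη' s).continuousAt
  have hf' : ∀ s, HasDerivWithinAt (fun s => charFun μ (η s))
      ((‖ContinuousLinearMap.adjoint G (η s)‖ ^ 2 / 2 : ℝ) * charFun μ (η s)) (Set.Ici s) s := by
    intro s
    refine hasDerivWithinAt_of_norm_sub_mul_exp_le (D := C * ‖η s‖) fun δ hδ => ?_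
    have h1 := hC δ hδ (η s)
    rw [hadj] at h1
    have h2 : exp (δ • star a) (η s) = η (s + δ) := by
      simp only [hη]
      rw [add_comm, exp_add_smul_eq_mul]
      rfl
    rw [h2, mul_div_assoc] at h1
    exact h1
  -- The derivative is `⟨η, (a Q + Q a*) η⟩`, evaluated by the Lyapunov equation.
  have hq' : ∀ s, HasDerivAt (fun s => (inner ℝ (η s) (Q (η s)) : ℝ))
      (-‖ContinuousLinearMap.adjoint G (η s)‖ ^ 2) s := by
    intro s
    have h1 := (hη' s).inner ℝ (Q.hasFDerivAt.comp_hasDerivAt s (hη' s))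
    refine h1.congr_deriv ?_
    have h2 := congrArg (fun T : E →L[ℝ] E =>
      (inner ℝ (η s) (T (η s)) : ℝ)) hQ
    simp only [_root_.add_apply, _root_.neg_apply,
      mul_apply_eq_comp, ContinuousLinearMap.comp_apply, inner_add_right,
      inner_neg_right] at h2
    rw [← ContinuousLinearMap.adjoint_inner_left G, real_inner_self_eq_norm_sq] at h2
    rw [← h2, ContinuousLinearMap.star_eq_adjoint, ContinuousLinearMap.adjoint_inner_left,
      Function.comp_apply]
    exact add_comm _ _
  -- The two logarithmic derivatives cancel, so `H` is constant. The expansion looks only forward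
  -- along the orbit, hence the one-sided derivatives. The constant is the limit `1`, since `η n →
  -- 0`.
  set H : ℝ → ℂ := fun s => charFun μ (η s) * Complex.exp ((inner ℝ (η s) (Q (η s)) / 2 : ℝ))
    with hH
  have hF' : ∀ s, HasDerivWithinAt H 0 (Set.Ici s) s := by
    intro s
    have h1 : HasDerivAt (fun s => (((inner ℝ (η s) (Q (η s)) : ℝ) / 2 : ℝ) : ℂ)) _ s :=
      ((hq' s).div_const 2).ofReal_comp
    refine ((hf' s).mul h1.cexp.hasDerivWithinAt).congr_deriv ?_
    push_cast
    ring
  have hFc : Continuous H := by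
    refine (continuous_charFun.comp hηc).mul ?_
    exact Complex.continuous_exp.comp (Complex.continuous_ofReal.comp
      ((hηc.inner (Q.continuous.comp hηc)).div_const 2))
  have hconst : ∀ n : ℕ, H n = H 0 := fun n =>
    constant_of_has_deriv_right_zero hFc.continuousOn (fun s _ => hF' s) n
      ⟨Nat.cast_nonneg n, le_rfl⟩
  have hη0 : Tendsto (fun n : ℕ => η n) atTop (𝓝 0) := by
    have h1 := (hstable).star
    have h2 : ∀ n : ℕ, star (exp ((n : ℝ) • a))
        = exp ((n : ℝ) • star a) := fun n => hadj n
    simp_rw [h2] at h1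
    rw [star_zero] at h1
    exact ((ContinuousLinearMap.apply ℝ E ξ).continuous.tendsto 0).comp h1
  have hlim : Tendsto (fun n : ℕ => H n) atTop (𝓝 1) := by
    have hcont : Continuous fun x : E =>
        charFun μ x * Complex.exp ((inner ℝ x (Q x) / 2 : ℝ)) :=
      continuous_charFun.mul (Complex.continuous_exp.comp (Complex.continuous_ofReal.comp
        ((continuous_id.inner Q.continuous).div_const 2)))
    have h1 := (hcont.tendsto 0).comp hη0
    refine h1.congr' (.of_forall fun n => rfl) |>.trans (le_of_eq ?_)
    simp
  simp_rw [hconst] at hlim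
  have hF0 : H 0 = 1 := tendsto_nhds_unique tendsto_const_nhds hlim
  have hη00 : η 0 = ξ := by
    simp only [hη, zero_smul, NormedSpace.exp_zero, one_apply_eq_self]
  simp only [hH, hη00] at hF0
  rw [Complex.exp_neg]
  exact eq_inv_of_mul_eq_one_left hF0

end StationaryCharFun

/-! ### Rayleigh quotient bounds -/

section Rayleigh

variable {ι : Type*} [Fintype ι] [DecidableEq ι]

theorem dotProduct_mulVec_le_lambdaMax {M : Matrix ι ι ℝ} (hM : M.IsHermitian) (x : ι → ℝ) :
    x ⬝ᵥ M *ᵥ x ≤ lambdaMax M * (x ⬝ᵥ x) := by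
  have h1 : (algebraMap ℝ (Matrix ι ι ℝ) (lambdaMax M) - M).PosSemidef := by
    rw [posSemidef_iff_isHermitian_and_spectrum_nonneg]
    refine ⟨IsHermitian.sub ?_ hM, ?_⟩
    · rw [Algebra.algebraMap_eq_smul_one, IsHermitian, conjTranspose_smul, conjTranspose_one,
        star_trivial]
    · rw [← spectrum.singleton_sub_eq, Set.singleton_sub]
      rintro _ ⟨s, hs, rfl⟩
      exact sub_nonneg.2 (le_csSup M.finite_real_spectrum.bddAbove hs)
  have h2 := h1.dotProduct_mulVec_nonneg x
  rw [star_trivial, Algebra.algebraMap_eq_smul_one, sub_mulVec, smul_mulVec, one_mulVec,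
    dotProduct_sub, dotProduct_smul, smul_eq_mul] at h2
  linarith

theorem lambdaMin_le_dotProduct_mulVec {M : Matrix ι ι ℝ} (hM : M.IsHermitian) (x : ι → ℝ) :
    lambdaMin M * (x ⬝ᵥ x) ≤ x ⬝ᵥ M *ᵥ x := by
  have h1 : (M - algebraMap ℝ (Matrix ι ι ℝ) (lambdaMin M)).PosSemidef := by
    rw [posSemidef_iff_isHermitian_and_spectrum_nonneg]
    refine ⟨IsHermitian.sub hM ?_, ?_⟩
    · rw [Algebra.algebraMap_eq_smul_one, IsHermitian, conjTranspose_smul, conjTranspose_one,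
        star_trivial]
    · rw [← spectrum.sub_singleton_eq, Set.sub_singleton]
      rintro _ ⟨s, hs, rfl⟩
      exact sub_nonneg.2 (csInf_le M.finite_real_spectrum.bddBelow hs)
  have h2 := h1.dotProduct_mulVec_nonneg x
  rw [star_trivial, Algebra.algebraMap_eq_smul_one, sub_mulVec, smul_mulVec, one_mulVec,
    dotProduct_sub, dotProduct_smul, smul_eq_mul] at h2
  linarith

end Rayleigh

/-! ### Gaussianity, Lyapunov equation and positivity of the covariance -/

section StationaryCovariance

variable {Ω ι κ : Type*} [MeasurableSpace Ω] [Fintype ι] [DecidableEq ι] [Fintype κ]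
  [DecidableEq κ] {B K : Matrix ι ι ℝ} {A : Matrix ι κ ℝ} {P : Measure Ω} [IsProbabilityMeasure P]
  {W : ℝ≥0 → Ω → EuclideanSpace ℝ κ} {Z : ℝ≥0 → Ω → EuclideanSpace ℝ ι}

theorem toEuclideanCLM_mul_transpose (A : Matrix ι κ ℝ) :
    toEuclideanCLM (n := ι) (𝕜 := ℝ) (A * Aᵀ) = (toEuclideanLin A).toContinuousLinearMap ∘L
      ContinuousLinearMap.adjoint (toEuclideanLin A).toContinuousLinearMap := by
  have h1 : ContinuousLinearMap.adjoint (toEuclideanLin A).toContinuousLinearMap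
      = (toEuclideanLin Aᵀ).toContinuousLinearMap := by
    refine ((ContinuousLinearMap.eq_adjoint_iff _ _).2 fun x y => ?_).symm
    change inner ℝ (toEuclideanLin Aᵀ x) y = inner ℝ x (toEuclideanLin A y)
    rw [EuclideanSpace.inner_eq_star_dotProduct, EuclideanSpace.inner_eq_star_dotProduct,
      star_trivial, star_trivial]
    change y.ofLp ⬝ᵥ Aᵀ *ᵥ x.ofLp = (A *ᵥ y.ofLp) ⬝ᵥ x.ofLp
    rw [dotProduct_transpose_mulVec, dotProduct_comm]
  rw [h1]
  ext x i
  change ((A * Aᵀ) *ᵥ x.ofLp) i = (A *ᵥ (Aᵀ *ᵥ x.ofLp)) i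
  rw [mulVec_mulVec]

/-- The law of a stationary solution is a centered Gaussian, and its covariance matrix solves the
Lyapunov equation. -/
theorem stationary_eq_multivariateGaussian (hB : IsHurwitz B) (hW : IsBrownianMotion W P)
    (hZ : IsLinearSDESolution B A W Z P) {μ : Measure (EuclideanSpace ℝ ι)}
    (hμ : ∀ t : ℝ≥0, P.map (Z t) = μ) :
    (covarianceMatrix μ).PosSemidef ∧
      B * covarianceMatrix μ + covarianceMatrix μ * Bᵀ = -(A * Aᵀ) ∧
      μ = multivariateGaussian 0 (covarianceMatrix μ) := by
  have hprob : IsProbabilityMeasure μ := by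
    rw [← hμ 0]
    exact Measure.isProbabilityMeasure_map (hZ.measurable 0).aemeasurable
  have hstable := hB.tendsto_exp
  set Ψ := toEuclideanCLM (n := ι) (𝕜 := ℝ) with hΨ
  set G := (toEuclideanLin A).toContinuousLinearMap with hG
  have hAA : Ψ (A * Aᵀ) = G ∘L ContinuousLinearMap.adjoint G := toEuclideanCLM_mul_transpose A
  have hsa : IsSelfAdjoint (G ∘L ContinuousLinearMap.adjoint G) := by
    rw [← hAA, IsSelfAdjoint, ← map_star, star_eq_conjTranspose,
      conjTranspose_eq_transpose_of_trivial, transpose_mul, transpose_transpose]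
  obtain ⟨Q', hQsa, hQ⟩ := exists_isSelfAdjoint_lyapunov hstable hsa
  obtain ⟨Q, rfl⟩ := EquivLike.surjective Ψ Q'
  obtain ⟨C, -, hC⟩ := exists_enorm_charFun_sub_le hW hZ hμ
  have hchar : ∀ ξ : EuclideanSpace ℝ ι,
      charFun μ ξ = Complex.exp (-(ξ.ofLp ⬝ᵥ Q *ᵥ ξ.ofLp / 2 : ℝ)) := by
    intro ξ
    rw [charFun_eq_exp_of_norm_charFun_sub_le hstable hQ hC ξ]
    have : inner ℝ ξ (Ψ Q ξ) = ξ.ofLp ⬝ᵥ Q *ᵥ ξ.ofLp := by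
      rw [EuclideanSpace.inner_eq_star_dotProduct, star_trivial, dotProduct_comm]
      rfl
    rw [this]
  have hQh : Q.IsHermitian := by
    apply EquivLike.injective Ψ
    rw [← star_eq_conjTranspose, map_star]
    exact hQsa
  -- Positivity comes for free: a characteristic function is bounded by `1`.
  have hQps : Q.PosSemidef := by
    refine .of_dotProduct_mulVec_nonneg hQh fun x => ?_
    rw [star_trivial]
    have h1 := norm_charFun_le_one (μ := μ) (WithLp.toLp 2 x)
    rw [hchar, ← Complex.ofReal_neg, Complex.norm_exp_ofReal, Real.exp_le_one_iff] at h1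
    linarith
  have hlyap : B * Q + Q * Bᵀ = -(A * Aᵀ) := by
    apply EquivLike.injective Ψ
    rw [map_add, map_mul, map_mul, map_neg, hAA, ← hQ, ← map_star, star_eq_conjTranspose,
      conjTranspose_eq_transpose_of_trivial]
  have hμG : μ = multivariateGaussian 0 Q := by
    refine Measure.ext_of_charFun (funext fun ξ => ?_)
    rw [hchar, charFun_multivariateGaussian hQps]
    congr 1
    simp
  have hK : covarianceMatrix μ = Q := by
    ext i j
    rw [hμG]
    exact covariance_eval_multivariateGaussian hQps i j
  rw [hK]
  exact ⟨hQps, hlyap, hμG⟩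

/-- The vector `x` is orthogonal to all columns of the controllability matrix, and by the rank
condition these span the space. -/
theorem IsControllable.eq_zero (hBA : IsControllable B A) {x : ι → ℝ}
    (hx : ∀ k : ℕ, Aᵀ *ᵥ (Bᵀ ^ k *ᵥ x) = 0) : x = 0 := by
  have hrange : LinearMap.range (controllabilityMatrix B A).mulVecLin = ⊤ := by
    refine Submodule.eq_top_of_finrank_eq ?_
    rw [Module.finrank_fintype_fun_eq_card]
    exact hBA
  obtain ⟨y, hy⟩ := LinearMap.range_eq_top.1 hrange x
  have h1 : x ᵥ* controllabilityMatrix B A = 0 := by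
    ext p
    have h2 := congrFun (hx p.1) p.2
    rw [mulVec_mulVec, ← transpose_pow, ← transpose_mul, mulVec_transpose] at h2
    exact h2
  have h3 : x ⬝ᵥ x = 0 := by
    calc x ⬝ᵥ x = x ⬝ᵥ controllabilityMatrix B A *ᵥ y := by rw [← hy]; rfl
      _ = 0 := by rw [dotProduct_mulVec, h1, zero_dotProduct]
  exact dotProduct_self_eq_zero.1 h3

/-- A positive semidefinite solution of the Lyapunov equation of a controllable pair is positive
definite. -/
theorem IsControllable.posDef (hBA : IsControllable B A) (hK : K.PosSemidef)
    (hlyap : B * K + K * Bᵀ = -(A * Aᵀ)) : K.PosDef := by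
  -- The kernel of `K` lies in that of `Aᵀ` and is invariant under `Bᵀ`: pairing the Lyapunov
  -- equation with `x` gives `|Aᵀ x|² = 0`, and applying it to `x` then gives `K Bᵀ x = 0`.
  have hker : ∀ x, K *ᵥ x = 0 → Aᵀ *ᵥ x = 0 ∧ K *ᵥ (Bᵀ *ᵥ x) = 0 := by
    intro x hx
    have h1 := congrArg (fun M : Matrix ι ι ℝ => M *ᵥ x) hlyap
    simp only [add_mulVec, ← mulVec_mulVec, hx, mulVec_zero, zero_add, neg_mulVec] at h1
    have h2 : Aᵀ *ᵥ x = 0 := by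
      have h3 : x ⬝ᵥ K *ᵥ (Bᵀ *ᵥ x) = 0 := by
        rw [dotProduct_mulVec_comm_of_isHermitian hK.1, hx, zero_dotProduct]
      rw [h1, dotProduct_neg, neg_eq_zero, dotProduct_mulVec, ← mulVec_transpose] at h3
      exact dotProduct_self_eq_zero.1 h3
    refine ⟨h2, ?_⟩
    rw [h1, h2, mulVec_zero, neg_zero]
  refine .of_dotProduct_mulVec_pos hK.1 fun x hx =>
    (hK.dotProduct_mulVec_nonneg x).lt_of_ne' fun h0 => hx ?_
  rw [hK.dotProduct_mulVec_zero_iff] at h0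
  refine hBA.eq_zero fun k => (hker _ ?_).1
  induction k with
  | zero => simpa using h0
  | succ k ih =>
    rw [pow_succ', ← mulVec_mulVec]
    exact (hker _ ih).2

/-- Testing the Lyapunov equation against an eigenvector. -/
theorem eigenvalue_mul_eq_of_lyapunov (hK : K.IsHermitian) (hlyap : B * K + K * Bᵀ = -(A * Aᵀ))
    {v : ι → ℝ} {l : ℝ} (hv : K *ᵥ v = l • v) :
    l * (v ⬝ᵥ (-(B + Bᵀ)) *ᵥ v) = v ⬝ᵥ (A * Aᵀ) *ᵥ v := by
  have h1 := congrArg (fun M : Matrix ι ι ℝ => v ⬝ᵥ M *ᵥ v) hlyap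
  simp only [add_mulVec, ← mulVec_mulVec, neg_mulVec, dotProduct_add, dotProduct_neg] at h1
  rw [dotProduct_mulVec_comm_of_isHermitian hK, hv, mulVec_smul, dotProduct_smul,
    smul_dotProduct, smul_eq_mul, smul_eq_mul] at h1
  rw [neg_mulVec, add_mulVec, dotProduct_neg, dotProduct_add, ← mulVec_mulVec]
  linarith

end StationaryCovariance

/-! ### Conditional measures of a Gaussian -/

section GaussianConditional

variable {ι κ : Type*} [Fintype ι] [DecidableEq ι] [Fintype κ] [DecidableEq κ]

/-- With `L* L = K⁻¹`, the image of the standard Gaussian under `L⁻¹` has covariance `L⁻¹ (L⁻¹)* =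
K`; characteristic functions identify it. -/
theorem multivariateGaussian_eq_withDensity {K : Matrix ι ι ℝ} (hK : K.PosDef) :
    ∃ c : ℝ, 0 < c ∧ multivariateGaussian 0 K = volume.withDensity fun z =>
      ENNReal.ofReal (c * Real.exp (-(1 / 2) * (z.ofLp ⬝ᵥ K⁻¹ *ᵥ z.ofLp))) := by
  obtain ⟨L, hL, hLa⟩ := exists_continuousLinearEquiv_of_posDef hK.inv
  obtain ⟨c, hc, hmap⟩ := exists_map_stdGaussian_eq_withDensity L 0
  refine ⟨c, hc, ?_⟩
  simp only [sub_zero, hL, zero_add] at hmap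
  rw [← hmap]
  have hmeas : Measurable fun y : EuclideanSpace ℝ ι => L.symm y := L.symm.continuous.measurable
  have : IsProbabilityMeasure ((stdGaussian (EuclideanSpace ℝ ι)).map fun y => L.symm y) :=
    Measure.isProbabilityMeasure_map hmeas.aemeasurable
  refine Measure.ext_of_charFun (funext fun ξ => ?_)
  have h1 := charFun_map_clm (P := stdGaussian (EuclideanSpace ℝ ι))
    (L.symm : EuclideanSpace ℝ ι →L[ℝ] EuclideanSpace ℝ ι) measurable_id ξ
  simp only [Measure.map_id, ContinuousLinearEquiv.coe_coe, id] at h1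
  rw [h1, charFun_stdGaussian, charFun_multivariateGaussian hK.posSemidef,
    ← Complex.ofReal_pow, hLa, Matrix.nonsing_inv_nonsing_inv _ ((isUnit_iff_isUnit_det K).1 hK.isUnit)]
  congr 1
  simp [neg_div]

/-- The logarithmic Sobolev inequality for the conditional measures of a Gaussian. -/
theorem satisfiesLSI_conditionalMeasure {K : Matrix (ι ⊕ κ) (ι ⊕ κ) ℝ} (hK : K.PosDef) {l c : ℝ}
    (hl : 0 < l) (hc : 0 < c) (hKl : ∀ z, z ⬝ᵥ K *ᵥ z ≤ l * (z ⬝ᵥ z)) (x : EuclideanSpace ℝ ι) :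
    IsProbabilityMeasure (conditionalMeasure (κ := κ) (fun z =>
        c * Real.exp (-(1 / 2) * (z.ofLp ⬝ᵥ K⁻¹ *ᵥ z.ofLp))) x) ∧
      SatisfiesLSI (conditionalMeasure (κ := κ) (fun z =>
        c * Real.exp (-(1 / 2) * (z.ofLp ⬝ᵥ K⁻¹ *ᵥ z.ofLp))) x) (1 / l) := by
  set M := K⁻¹ with hM
  have hMpos : M.PosDef := hK.inv
  set D := M.toBlocks₂₂ with hD
  have hDpos : D.PosDef := hMpos.submatrix Sum.inr_injective
  have hMblocks : M = fromBlocks M.toBlocks₁₁ M.toBlocks₁₂ (M.toBlocks₁₂)ᴴ D := by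
    have h1 : (M.toBlocks₁₂)ᴴ = M.toBlocks₂₁ := by
      ext i j
      exact congrFun (congrFun hMpos.1 (Sum.inr i)) (Sum.inl j)
    rw [h1, hD, fromBlocks_toBlocks]
  let _ : Invertible D := hDpos.isUnit.invertible
  -- Completing the square in `y`: `m` is the conditional mean, and `s`, the Schur complement form
  -- in `x`, only contributes a constant factor to the density.
  set m : κ → ℝ := -((D⁻¹ * (M.toBlocks₁₂)ᴴ) *ᵥ x.ofLp) with hm
  set s : ℝ := x.ofLp ⬝ᵥ (M.toBlocks₁₁ - M.toBlocks₁₂ * D⁻¹ * (M.toBlocks₁₂)ᴴ) *ᵥ x.ofLp with hs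
  have hsq : ∀ y : κ → ℝ, Sum.elim x.ofLp y ⬝ᵥ M *ᵥ Sum.elim x.ofLp y
      = (y - m) ⬝ᵥ D *ᵥ (y - m) + s := by
    intro y
    have h1 := schur_complement_eq₂₂ M.toBlocks₁₁ M.toBlocks₁₂ x.ofLp y hDpos.1
    rw [← hMblocks, star_trivial, star_trivial, star_trivial, ← dotProduct_mulVec,
      ← dotProduct_mulVec, ← dotProduct_mulVec] at h1
    have h2 : y - m = (D⁻¹ * (M.toBlocks₁₂)ᴴ) *ᵥ x.ofLp + y := by
      rw [hm, sub_neg_eq_add, add_comm]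
    rw [h2]
    exact h1
  -- From `K ≤ l` follows `1 ≤ l K⁻¹`; testing with `(0, y)` passes this to the diagonal block.
  have hDl : ∀ y : κ → ℝ, y ⬝ᵥ y ≤ l * (y ⬝ᵥ D *ᵥ y) := by
    intro y
    have h1 := dotProduct_self_le_of_mulVec_le hK hl hKl (Sum.elim 0 y)
    rw [← hM, hMblocks, fromBlocks_mulVec] at h1
    simpa using h1
  obtain ⟨L, hL, hLa⟩ := exists_continuousLinearEquiv_of_posDef hDpos
  refine satisfiesLSI_of_gaussian_density L (WithLp.toLp 2 m)
    (K := c * Real.exp (-(1 / 2) * s)) (by positivity) hl (fun y => ?_) fun w => ?_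
  · have h1 : (joinPoint x y).ofLp = Sum.elim x.ofLp y.ofLp := rfl
    beta_reduce
    rw [h1, hsq, hL, mul_add, Real.exp_add, mul_comm (Real.exp _), mul_assoc]
    rfl
  · rw [hLa, EuclideanSpace.real_norm_sq_eq]
    refine (dotProduct_inv_mulVec_le hDpos hDl w.ofLp).trans (le_of_eq ?_)
    simp [dotProduct, sq]

end GaussianConditional

/-! ### Eigenvalue bounds and conclusion -/

theorem SatisfiesLSI.ofReal_le_logSobolevConstant {κ : Type*} [Fintype κ]
    {ν : Measure (EuclideanSpace ℝ κ)} {α : ℝ} (h : SatisfiesLSI ν α) :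
    ENNReal.ofReal α ≤ logSobolevConstant ν :=
  le_iSup₂ (f := fun (α : ℝ) (_ : SatisfiesLSI ν α) => ENNReal.ofReal α) α h

/-- The bounds may be negative and the constant infinite, so they are compared in `EReal`, where
neither is truncated. -/
theorem SatisfiesLSI.coe_le_logSobolevConstant {κ : Type*} [Fintype κ]
    {ν : Measure (EuclideanSpace ℝ κ)} {α β : ℝ} (h : SatisfiesLSI ν α) (hβ : β ≤ α) :
    (β : EReal) ≤ (logSobolevConstant ν : EReal) := by
  calc (β : EReal) ≤ (α : EReal) := EReal.coe_le_coe_iff.2 hβ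
    _ = ((ENNReal.ofReal α : ℝ≥0∞) : EReal) := by
        rw [EReal.coe_ennreal_ofReal, max_eq_left h.1.le]
    _ ≤ _ := EReal.coe_ennreal_le_coe_ennreal_iff.2 h.ofReal_le_logSobolevConstant

/-- Bounds relating the largest eigenvalue of a solution of the Lyapunov equation to the extreme
eigenvalues of the symmetric part of the drift. -/
theorem lambdaMin_div_lambdaMax_le {ι κ : Type*} [Fintype ι] [DecidableEq ι] [Fintype κ]
    [DecidableEq κ] {B K : Matrix ι ι ℝ} {A : Matrix ι κ ℝ} (hK : K.PosDef)
    (hlyap : B * K + K * Bᵀ = -(A * Aᵀ)) {v : ι → ℝ} {l : ℝ} (hv : K *ᵥ v = l • v)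
    (hvA : (A * Aᵀ) *ᵥ v ≠ 0) :
    0 < l ∧ lambdaMin (-(B + Bᵀ)) / lambdaMax (A * Aᵀ) ≤ 1 / l ∧
      lambdaMin (B + Bᵀ) / lambdaMax (A * Aᵀ) ≤ 0 := by
  have hv0 : v ≠ 0 := fun h => hvA (by rw [h, mulVec_zero])
  have hvv : 0 < v ⬝ᵥ v := by
    have h1 := dotProduct_star_self_pos_iff.2 hv0
    rwa [star_trivial] at h1
  have hl : 0 < l := by
    have h1 := hK.dotProduct_mulVec_pos hv0
    rw [star_trivial, hv, dotProduct_smul, smul_eq_mul] at h1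
    exact pos_of_mul_pos_left h1 hvv.le
  have hAAps : (A * Aᵀ).PosSemidef := by
    have h1 := posSemidef_self_mul_conjTranspose A
    rwa [conjTranspose_eq_transpose_of_trivial] at h1
  have hvAv : 0 < v ⬝ᵥ (A * Aᵀ) *ᵥ v := by
    have h1 := hAAps.dotProduct_mulVec_nonneg v
    refine lt_of_le_of_ne (by rwa [star_trivial] at h1) fun h0 => hvA ?_
    rw [← hAAps.dotProduct_mulVec_zero_iff, star_trivial, h0]
  have hmax := dotProduct_mulVec_le_lambdaMax hAAps.1 v
  have hmax0 : 0 < lambdaMax (A * Aᵀ) := pos_of_mul_pos_left (hvAv.trans_le hmax) hvv.le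
  have htest := eigenvalue_mul_eq_of_lyapunov hK.1 hlyap hv
  have hsymm : (B + Bᵀ).IsHermitian := by
    rw [IsHermitian, conjTranspose_eq_transpose_of_trivial, transpose_add, transpose_transpose,
      add_comm]
  have hmin1 := lambdaMin_le_dotProduct_mulVec hsymm.neg v
  have hmin2 := lambdaMin_le_dotProduct_mulVec hsymm v
  refine ⟨hl, ?_, ?_⟩
  · rw [div_le_div_iff₀ hmax0 hl, one_mul]
    have h1 : lambdaMin (-(B + Bᵀ)) * l * (v ⬝ᵥ v) ≤ lambdaMax (A * Aᵀ) * (v ⬝ᵥ v) := by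
      calc lambdaMin (-(B + Bᵀ)) * l * (v ⬝ᵥ v) = l * (lambdaMin (-(B + Bᵀ)) * (v ⬝ᵥ v)) := by ring
        _ ≤ l * (v ⬝ᵥ (-(B + Bᵀ)) *ᵥ v) := mul_le_mul_of_nonneg_left hmin1 hl.le
        _ ≤ _ := htest.trans_le hmax
    exact le_of_mul_le_mul_right h1 hvv
  · refine div_nonpos_of_nonpos_of_nonneg ?_ hmax0.le
    -- This is where `A Aᵀ v ≠ 0` enters: the symmetric part of `B` is negative along `v`, so its
    -- smallest eigenvalue cannot be positive.
    have h1 : 0 < v ⬝ᵥ (-(B + Bᵀ)) *ᵥ v := by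
      rw [← htest] at hvAv
      exact pos_of_mul_pos_right hvAv hl.le
    rw [neg_mulVec, dotProduct_neg] at h1
    by_contra hcon
    have h2 : 0 < lambdaMin (B + Bᵀ) * (v ⬝ᵥ v) := mul_pos (not_le.1 hcon) hvv
    linarith

theorem mainTheorem10 {nx ny m : ℕ}
    (B : Matrix (Fin nx ⊕ Fin ny) (Fin nx ⊕ Fin ny) ℝ)
    (A : Matrix (Fin nx ⊕ Fin ny) (Fin m) ℝ)
    (hB : IsHurwitz B) (hBA : IsControllable B A)
    {Ω : Type*} [MeasurableSpace Ω] (P : Measure Ω) [IsProbabilityMeasure P]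
    (W : ℝ≥0 → Ω → EuclideanSpace ℝ (Fin m)) (hW : IsBrownianMotion W P)
    (Z : ℝ≥0 → Ω → EuclideanSpace ℝ (Fin nx ⊕ Fin ny))
    (hZ : IsLinearSDESolution B A W Z P)
    (μ : Measure (EuclideanSpace ℝ (Fin nx ⊕ Fin ny)))
    (hμ : ∀ t : ℝ≥0, P.map (Z t) = μ)
    (v : Fin nx ⊕ Fin ny → ℝ)
    (hv : covarianceMatrix μ *ᵥ v = lambdaMax (covarianceMatrix μ) • v)
    (hvA : (A * Aᵀ) *ᵥ v ≠ 0) :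
    ∃ ρ : EuclideanSpace ℝ (Fin nx ⊕ Fin ny) → ℝ,
      Continuous ρ ∧ (∀ z, 0 < ρ z) ∧
      μ = volume.withDensity (fun z => ENNReal.ofReal (ρ z)) ∧
      ∀ x : EuclideanSpace ℝ (Fin nx),
        IsProbabilityMeasure (conditionalMeasure (κ := Fin ny) ρ x) ∧
        0 < logSobolevConstant (conditionalMeasure (κ := Fin ny) ρ x) ∧
        ((lambdaMin (-(B + Bᵀ)) / lambdaMax (A * Aᵀ) : ℝ) : EReal) ≤
          (logSobolevConstant (conditionalMeasure (κ := Fin ny) ρ x) : EReal) ∧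
        ((lambdaMin (B + Bᵀ) / lambdaMax (A * Aᵀ) : ℝ) : EReal) ≤
          (logSobolevConstant (conditionalMeasure (κ := Fin ny) ρ x) : EReal) := by
  obtain ⟨hKps, hlyap, hμK⟩ := stationary_eq_multivariateGaussian hB hW hZ hμ
  set K := covarianceMatrix μ with hKdef
  have hK : K.PosDef := hBA.posDef hKps hlyap
  obtain ⟨hl, h1, h2⟩ := lambdaMin_div_lambdaMax_le hK hlyap hv hvA
  obtain ⟨c, hc, hdens⟩ := multivariateGaussian_eq_withDensity hK
  refine ⟨fun z => c * Real.exp (-(1 / 2) * (z.ofLp ⬝ᵥ K⁻¹ *ᵥ z.ofLp)), ?_, fun z => by positivity,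
    hμK.trans hdens, fun x => ?_⟩
  · have hcont : Continuous fun z : EuclideanSpace ℝ (Fin nx ⊕ Fin ny) =>
        z.ofLp ⬝ᵥ K⁻¹ *ᵥ z.ofLp :=
      (PiLp.continuous_ofLp 2 _).dotProduct (continuous_const.matrix_mulVec
        (PiLp.continuous_ofLp 2 _))
    fun_prop
  -- Applied with `l = λ_max(K)`, so the inequality holds with constant `1/λ_max(K)` for every `x`.
  · obtain ⟨hprob, hLSI⟩ := satisfiesLSI_conditionalMeasure hK hl hc
      (dotProduct_mulVec_le_lambdaMax hK.1) x
    exact ⟨hprob, (ENNReal.ofReal_pos.2 hLSI.1).trans_le hLSI.ofReal_le_logSobolevConstant,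
      hLSI.coe_le_logSobolevConstant h1,
      hLSI.coe_le_logSobolevConstant (h2.trans hLSI.1.le)⟩
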